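/- Let $d\in\mathbb N$, $M=(\mathbb{R}^d\setminus\{0\})\times\mathbb{R}^d\ni(q,p)$ with symplectic form $\sum_k dp_k\wedge dq_k$, and write $r=|q|$, $p_r=(p\cdot q)/r$, $H_{\rm Kep}=\frac{p^2}{2}-\frac1r$. For $i\in\mathbb N$ and real coefficients $a_{l,m,n}$ put $$\Lambda_i(a)=\sum_{l+m+n=i}a_{l,m,n}\,\frac{(p^2)^l(p_r^2)^n}{r^m}.$$ **Theorem.** Let $f,g:\mathbb R\to\mathbb R$ be $C^\infty$ functions with $f(0)=0$, $f'(0)=1$, $g(0)=1$. Then there are a $C^\infty$ function $\tau:\mathbb R\to\mathbb R$ with $\tau(0)=0$, $\tau'(0)=1$, and real coefficients $a^{(1)},\dots,a^{(5)}$, such that the relation $$f(H)=\epsilon\,\frac{p^2}{2}-g(H)\,\frac{\epsilon}{r}$$ is solved through post-Newtonian order 5 (that is, through order $\epsilon^6$) by $H=\Phi_\epsilon^*\,\tau(\epsilon H_{\rm Kep})=\tau(\epsilon\, H_{\rm Kep}\circ\Phi_\epsilon)$ with a near-identity canonical transformation $\Phi_\epsilon$. Precisely: for every compact $K\subset M$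 there are an open set $U$ with $K\subset U\subset M$, constants $\epsilon_0>0$ and $C$, and maps $\Phi_\epsilon:U\to M$ for $|\epsilon|<\epsilon_0$ such that 1. $(\epsilon,x)\mapsto\Phi_\epsilon(x)$ is $C^\infty$ on $(-\epsilon_0,\epsilon_0)\times U$, $\Phi_0=\mathrm{id}$, and each $\Phi_\epsilon$ is injective and preserves the symplectic form; 2. $\Phi_\epsilon=\Phi_{1,\epsilon}\circ\Phi_{2,\epsilon}\circ\dots\circ\Phi_{5,\epsilon}$ on $U$, so that $\Phi_\epsilon^*=\Phi_{5,\epsilon}^*\cdots\Phi_{1,\epsilon}^*$, where $\Phi_{i,\epsilon}$ is the Lie transform, i.e. the time-one map of the Hamiltonian flow, with generator $\epsilon^i\,(p\cdot q)\,\Lambda_i(a^{(i)})$ (and all these flows exist up to time one along the composition); 3. for all $|\epsilon|<\epsilon_0$ and $(q,p)\in U$, the function $H=\tau(\epsilon\, H_{\rm Kep}\circ\Phi_\epsilon)$ satisfies $$\Big|f(H)-\epsilon\,\frac{p^2}{2}+g(H)\,\frac{\epsilon}{r}\Big|\le C\,|\epsilon|^{7}.$$ -/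

import Mathlib

open Set
open scoped ContDiff

noncomputable section

namespace PNKepler

/-- Phase space coordinates `x = (q, p)` on `ℝ^d × ℝ^d`. -/
abbrev PhaseSpace (d : ℕ) : Type := EuclideanSpace ℝ (Fin d) × EuclideanSpace ℝ (Fin d)

/-- `T^*ℝ₀^d = (ℝ^d - {0}) × ℝ^d`. -/
def puncturedPhaseSpace (d : ℕ) : Set (PhaseSpace d) := {x | x.1 ≠ 0}

/-- The radius `r = |q|`. -/
def radius {d : ℕ} (x : PhaseSpace d) : ℝ := ‖x.1‖

/-- The squared momentum `p²`. -/
def momentumSq {d : ℕ} (x : PhaseSpace d) : ℝ := ‖x.2‖ ^ 2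

/-- The inner product `p · q`. -/
def pDotQ {d : ℕ} (x : PhaseSpace d) : ℝ := inner ℝ x.2 x.1

/-- The radial momentum `p_r = (p · q) / r`. -/
def radialMomentum {d : ℕ} (x : PhaseSpace d) : ℝ := pDotQ x / radius x

/-- The Kepler Hamiltonian `p² / 2 - 1 / r`. -/
def keplerHamiltonian {d : ℕ} (x : PhaseSpace d) : ℝ := momentumSq x / 2 - 1 / radius x

/-- The general function of post-Newtonian weight `i`:
`Λ_i(a) = ∑_{l + m + n = i} a_{l,m,n} (p²)^l (p_r²)^n / r^m`. -/
def pnPolynomial {d : ℕ} (i : ℕ) (a : ℕ → ℕ → ℕ → ℝ) (x : PhaseSpace d) : ℝ :=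
  ∑ k ∈ Finset.Nat.antidiagonalTuple 3 i,
    a (k 0) (k 1) (k 2) *
      (momentumSq x ^ k 0 * (radialMomentum x ^ 2) ^ k 2 / radius x ^ k 1)

/-- The generating function `(p · q) Λ_i(a)`. -/
def lieGenerator {d : ℕ} (i : ℕ) (a : ℕ → ℕ → ℕ → ℝ) (x : PhaseSpace d) : ℝ :=
  pDotQ x * pnPolynomial i a x

/-- The Hamiltonian vector field `X_G = (∂G/∂p, -∂G/∂q)`. -/
def hamiltonianVectorField {d : ℕ} (G : PhaseSpace d → ℝ) (x : PhaseSpace d) : PhaseSpace d :=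
  (gradient (fun p => G (x.1, p)) x.2, -gradient (fun q => G (q, x.2)) x.1)

/-- The time-one map of the Hamiltonian flow of `G` on `T^*ℝ₀^d` is defined at `x` and takes the
value `y` there: there is a solution of Hamilton's equations on `[0, 1]` from `x` to `y`. -/
def TimeOneFlow {d : ℕ} (G : PhaseSpace d → ℝ) (x y : PhaseSpace d) : Prop :=
  ∃ γ : ℝ → PhaseSpace d, γ 0 = x ∧ γ 1 = y ∧
    ∀ t ∈ Icc (0 : ℝ) 1, γ t ∈ puncturedPhaseSpace d ∧
      HasDerivWithinAt γ (hamiltonianVectorField G (γ t)) (Icc 0 1) t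

/-- The standard symplectic form `ω = ∑ₖ dpₖ ∧ dqₖ`. -/
def symplecticForm {d : ℕ} (v w : PhaseSpace d) : ℝ :=
  inner ℝ v.2 w.1 - inner ℝ v.1 w.2

/-- `φ` is a (smooth) canonical transformation of the open set `U ⊆ T^*ℝ₀^d` onto its image in
`T^*ℝ₀^d`. -/
structure IsCanonicalOn {d : ℕ} (φ : PhaseSpace d → PhaseSpace d) (U : Set (PhaseSpace d)) :
    Prop where
  mapsTo : MapsTo φ U (puncturedPhaseSpace d)
  injOn : InjOn φ U
  contDiffOn : ContDiffOn ℝ ∞ φ U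
  symplectic : ∀ x ∈ U, ∀ v w : PhaseSpace d,
    symplecticForm (fderiv ℝ φ x v) (fderiv ℝ φ x w) = symplecticForm v w

/-- `Φ ε`, `|ε| < ε₀`, is a near-identity canonical transformation on the open set `U`: a family
of canonical transformations that depends smoothly on `(ε, x)` and is the identity at `ε = 0`. -/
structure IsNearIdentityCanonicalOn {d : ℕ} (Φ : ℝ → PhaseSpace d → PhaseSpace d) (ε₀ : ℝ)
    (U : Set (PhaseSpace d)) : Prop where
  canonical : ∀ ε ∈ Ioo (-ε₀) ε₀, IsCanonicalOn (Φ ε) U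
  smooth : ContDiffOn ℝ ∞ (fun y : ℝ × PhaseSpace d => Φ y.1 y.2) (Ioo (-ε₀) ε₀ ×ˢ U)
  at_zero : ∀ x ∈ U, Φ 0 x = x

/-- On `U` the map `φ` is the composition `Φ₁ ∘ Φ₂ ∘ ⋯ ∘ Φ_N` (so that
`φ^* = Φ_N^* ⋯ Φ₂^* Φ₁^*`), where `Φ_i` is the time-one map of the Hamiltonian flow of
`ε^i (p · q) Λ_i(a_i)`. Here `z i` is the intermediate point `(Φ_{i+1} ∘ ⋯ ∘ Φ_N) x`. -/
def IsLieTransformComposition {d : ℕ} (N : ℕ) (a : ℕ → ℕ → ℕ → ℕ → ℝ) (ε : ℝ)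
    (φ : PhaseSpace d → PhaseSpace d) (U : Set (PhaseSpace d)) : Prop :=
  ∀ x ∈ U, ∃ z : ℕ → PhaseSpace d, z N = x ∧ z 0 = φ x ∧
    ∀ i ∈ Finset.Icc 1 N,
      TimeOneFlow (fun y => ε ^ i * lieGenerator i (a i) y) (z i) (z (i - 1))

end PNKepler

end

/-!
For a fixed value of `H`, the relation `f(H) = ε p² / 2 - g(H) ε / r` describes a Kepler problem
with coupling `g(H)`. The scaling `(q, p) ↦ (q / g, g p)` turns it into `f(H) / g(H)² = ε H_Kep`.
Hence the energy must be `H = τ(y)` with `y = ε H_Kep ∘ Φ_ε` and `τ` the inverse of `f / g²` near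
`0`, multiplied by a bump function to be defined everywhere (`exists_contDiff_inverse`). With
`γ = g ∘ τ` the relation becomes `y γ(y)² = ε p² / 2 - γ(y) ε / r` near `y = 0`. It involves only
the Taylor coefficients of `γ`, of which those up to order five matter here.

*Algebra.* Polynomials in `H_Kep`, `p_r²` and `1 / r` are stable under `{·, (p · q) Λ}` for a
polynomial `Λ` of the same kind; the bracket is the derivation `PNKepler.bracket`. The pullback of
`H_Kep` by the five Lie transforms therefore has a formal expansion in `ε` with such polynomials as
coefficients. Matching it with the formal solution `y` of the relation determines
`Λ_1, …, Λ_5` one after the other (`PNKepler.lieCoeff`). That these polynomials have the required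
property is an identity of polynomials at each order (`PNKepler.coeff_pullbackSeries`,
`PNKepler.coeff_residualSeries`). Homogeneity of `Λ_i` turns it into a function `Λ_i(a)`
(`PNKepler.exists_pnPolynomial_eq`).

*Analysis.* The flow of a smooth vector field is smooth jointly in time and initial point
(`exists_nhds_flowMap`): superposition with a smooth map is a smooth operator on continuous
curves, so that the inverse function theorem applies to the integral equation
(`exists_contDiffAt_integral_solution`). By the variational equation, a Hamiltonian flow is
symplectic (`bilin_fderiv_flowMap`). Along the flow of `(p · q) Λ`, derivatives of polynomial
observables are given by `PNKepler.bracket`, and repeated use of the mean value inequality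
shows that the formal Lie series are asymptotic expansions, uniformly near every point
(`PNKepler.HasExpansion.genFlow`). Compactness of `K` makes the local estimates uniform on a
neighbourhood of `K` (`PNKepler.exists_lieTransform_solution`).
-/

open Filter Topology

universe u

/-! ### Superposition operators on spaces of continuous functions -/

section Superposition

variable {I : Type*} [TopologicalSpace I] [CompactSpace I]

/-- Pointwise application of a continuous family of continuous linear maps to a continuous family
of vectors, as a continuous bilinear map for the supremum norms. -/
noncomputable def ContinuousMap.applyCLM (I : Type*) [TopologicalSpace I] [CompactSpace I]
    (E F : Type*) [NormedAddCommGroup E] [NormedSpace ℝ E] [NormedAddCommGroup F]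
    [NormedSpace ℝ F] : C(I, E →L[ℝ] F) →L[ℝ] C(I, E) →L[ℝ] C(I, F) :=
  LinearMap.mkContinuous₂
    (LinearMap.mk₂ ℝ
      (fun (A : C(I, E →L[ℝ] F)) (h : C(I, E)) =>
        (⟨fun t => A t (h t), A.continuous.clm_apply h.continuous⟩ : C(I, F)))
      (fun A B h => by ext t; simp) (fun c A h => by ext t; simp)
      (fun A h k => by ext t; simp) (fun c A h => by ext t; simp)) 1
    (fun A h => by
      refine (ContinuousMap.norm_le _ (by positivity)).2 fun t => ?_
      rw [one_mul]
      exact ((A t).le_opNorm (h t)).trans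
        (mul_le_mul (A.norm_coe_le_norm t) (h.norm_coe_le_norm t) (norm_nonneg _) (norm_nonneg A)))

variable {E F : Type*} [NormedAddCommGroup E] [NormedSpace ℝ E] [NormedAddCommGroup F]
  [NormedSpace ℝ F]

lemma hasFDerivAt_comp_continuousMap {f : E → F} {f' : E → E →L[ℝ] F}
    (hf : ∀ x, HasFDerivAt f (f' x) x) (hfc : Continuous f) (hf' : Continuous f') (α : C(I, E)) :
    HasFDerivAt (fun β : C(I, E) => (ContinuousMap.mk f hfc).comp β)
      (ContinuousMap.applyCLM I E F ((ContinuousMap.mk f' hf').comp α)) α := by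
  rw [hasFDerivAt_iff_isLittleO_nhds_zero, Asymptotics.isLittleO_iff]
  intro ε hε
  obtain ⟨δ, hδ, hball⟩ := (Metric.continuous_iff
    (f := fun β : C(I, E) => (ContinuousMap.mk f' hf').comp β)).1
    (by exact ContinuousMap.continuous_postcomp (ContinuousMap.mk f' hf')) α ε hε
  filter_upwards [Metric.ball_mem_nhds (0 : C(I, E)) hδ] with h hh
  rw [mem_ball_zero_iff] at hh
  refine (ContinuousMap.norm_le _ (by positivity)).2 fun t => ?_
  have key : ∀ y ∈ Metric.ball (α t) δ, ‖f' y - f' (α t)‖ ≤ ε := by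
    intro y hy
    -- every point near `α t` is the value at `t` of a translate of `α`
    have hd : dist (α + ContinuousMap.const I (y - α t)) α < δ := by
      rw [dist_eq_norm, add_sub_cancel_left]
      refine lt_of_le_of_lt ((ContinuousMap.norm_le _ (norm_nonneg (y - α t))).2 fun _ => ?_)
        (by rwa [mem_ball_iff_norm] at hy)
      simp
    have h1 := hball _ hd
    have h2 := (ContinuousMap.dist_apply_le_dist t).trans_lt h1
    rw [dist_eq_norm] at h2
    simpa using h2.le
  have hmem : α t + h t ∈ Metric.ball (α t) δ := by
    rw [mem_ball_iff_norm, add_sub_cancel_left]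
    exact (h.norm_coe_le_norm t).trans_lt hh
  have h3 := (convex_ball (α t) δ).norm_image_sub_le_of_norm_hasFDerivWithin_le'
    (fun x _ => (hf x).hasFDerivWithinAt) key (Metric.mem_ball_self hδ) hmem
  rw [add_sub_cancel_left] at h3
  exact h3.trans (mul_le_mul_of_nonneg_left (h.norm_coe_le_norm t) hε.le)

end Superposition


/-- Superposition with a smooth map is a smooth operator on continuous functions. -/
theorem contDiff_comp_continuousMap {I : Type*} [TopologicalSpace I] [CompactSpace I]
    {E : Type u} [NormedAddCommGroup E] [NormedSpace ℝ E] (n : ℕ) :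
    ∀ {F : Type u} [NormedAddCommGroup F] [NormedSpace ℝ F] {f : E → F} (hfc : Continuous f),
      ContDiff ℝ n f → ContDiff ℝ n (fun β : C(I, E) => (ContinuousMap.mk f hfc).comp β) := by
  induction n with
  | zero =>
    intro F _ _ f hfc _
    exact contDiff_zero.2 (ContinuousMap.continuous_postcomp _)
  | succ n ih =>
    intro F _ _ f hfc hf
    have hf1 : ContDiff ℝ (n + 1 : ℕ) f := hf
    push_cast at hf1 ⊢
    obtain ⟨f', hf', hd⟩ := contDiff_succ_iff_hasFDerivAt.1 hf1
    refine contDiff_succ_iff_hasFDerivAt.2 ⟨_, ?_, fun α =>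
      hasFDerivAt_comp_continuousMap hd hfc hf'.continuous α⟩
    exact (ContinuousMap.applyCLM I E F).contDiff.comp (ih hf'.continuous hf')

/-! ### Flows of smooth vector fields -/

/-- The indefinite integral from `0`, as an operator on `C([0, 1], E)`. -/
noncomputable def primitiveCLM (E : Type*) [NormedAddCommGroup E] [NormedSpace ℝ E]
    [CompleteSpace E] : C(Icc (0 : ℝ) 1, E) →L[ℝ] C(Icc (0 : ℝ) 1, E) :=
  LinearMap.mkContinuous
    { toFun := fun α => ⟨fun t => ∫ τ in (0 : ℝ)..t, IccExtend zero_le_one α τ, by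
        have h : Continuous (IccExtend (zero_le_one' ℝ) α) := α.continuous.Icc_extend'
        exact (intervalIntegral.continuous_primitive (fun _ _ => h.intervalIntegrable _ _) 0).comp
          continuous_subtype_val⟩
      map_add' := fun α β => by
        ext t
        have h : Continuous (IccExtend (zero_le_one' ℝ) α) := α.continuous.Icc_extend'
        have h' : Continuous (IccExtend (zero_le_one' ℝ) β) := β.continuous.Icc_extend'
        exact intervalIntegral.integral_add (h.intervalIntegrable _ _) (h'.intervalIntegrable _ _)
      map_smul' := fun c α => by
        ext t
        exact intervalIntegral.integral_smul c _ } 1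
    (fun α => by
      refine (ContinuousMap.norm_le _ (by positivity)).2 fun t => ?_
      have h := intervalIntegral.norm_integral_le_of_norm_le_const (a := (0 : ℝ)) (b := t)
        (f := IccExtend (zero_le_one' ℝ) α) (C := ‖α‖) (fun x _ => α.norm_coe_le_norm _)
      refine h.trans ?_
      rw [one_mul, sub_zero, abs_of_nonneg t.2.1]
      exact mul_le_of_le_one_right (norm_nonneg _) t.2.2)

/-- The integral equation of the initial value problem `γ' = s X(γ)`, `γ(0) = x` is solvable near
`s = 0`, and its solution depends smoothly on `(s, x)`: by the inverse function theorem for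
`(s, x, α) ↦ (s, x, α - x - s ∫ X ∘ α)` on `ℝ × E × C([0, 1], E)`. -/
theorem exists_contDiffAt_integral_solution {E : Type u} [NormedAddCommGroup E] [NormedSpace ℝ E]
    [CompleteSpace E] {X : E → E} (hX : ContDiff ℝ ∞ X) (x₀ : E) :
    ∃ S : ℝ × E → C(Icc (0 : ℝ) 1, E), S (0, x₀) = ContinuousMap.const _ x₀ ∧
      ∀ᶠ p in 𝓝 ((0 : ℝ), x₀), ContDiffAt ℝ ∞ S p ∧
        S p = ContinuousMap.const _ p.2 +
          p.1 • primitiveCLM E ((ContinuousMap.mk X hX.continuous).comp (S p)) := by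
  let cst : E →L[ℝ] C(Icc (0 : ℝ) 1, E) := ContinuousLinearMap.const ℝ (Icc (0 : ℝ) 1)
  set N : C(Icc (0 : ℝ) 1, E) → C(Icc (0 : ℝ) 1, E) :=
    fun α => (ContinuousMap.mk X hX.continuous).comp α with hN
  have hNs : ContDiff ℝ ∞ N := contDiff_infty.2 fun n =>
    contDiff_comp_continuousMap n hX.continuous (hX.of_le (by exact_mod_cast le_top))
  set f : (ℝ × E) × C(Icc (0 : ℝ) 1, E) → (ℝ × E) × C(Icc (0 : ℝ) 1, E) :=
    fun u => (u.1, u.2 - cst u.1.2 - u.1.1 • primitiveCLM E (N u.2)) with hf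
  have hfs : ContDiff ℝ ∞ f := by
    have h1 : ContDiff ℝ ∞ fun u : (ℝ × E) × C(Icc (0 : ℝ) 1, E) => cst u.1.2 :=
      cst.contDiff.comp (contDiff_snd.comp contDiff_fst)
    have h2 : ContDiff ℝ ∞ fun u : (ℝ × E) × C(Icc (0 : ℝ) 1, E) => primitiveCLM E (N u.2) :=
      (primitiveCLM E).contDiff.comp (hNs.comp contDiff_snd)
    exact contDiff_fst.prodMk ((contDiff_snd.sub h1).sub
      ((contDiff_fst.comp contDiff_fst).smul h2))
  set α₀ := cst x₀ with hα₀
  set u₀ : (ℝ × E) × C(Icc (0 : ℝ) 1, E) := ((0, x₀), α₀) with hu₀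
  set v := primitiveCLM E (N α₀) with hv
  let A : (ℝ × E) × C(Icc (0 : ℝ) 1, E) →L[ℝ] C(Icc (0 : ℝ) 1, E) :=
    cst.comp ((ContinuousLinearMap.snd ℝ ℝ E).comp (.fst ℝ _ _)) +
      ((ContinuousLinearMap.fst ℝ ℝ E).comp (.fst ℝ _ _)).smulRight v
  have hA : ∀ w, A w = cst w.1.2 + w.1.1 • v := fun w => rfl
  let e : ((ℝ × E) × C(Icc (0 : ℝ) 1, E)) ≃L[ℝ] ((ℝ × E) × C(Icc (0 : ℝ) 1, E)) :=
    ContinuousLinearEquiv.equivOfInverse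
      ((ContinuousLinearMap.fst ℝ _ _).prod (.snd ℝ _ _ - A))
      ((ContinuousLinearMap.fst ℝ _ _).prod (.snd ℝ _ _ + A))
      (fun w => by ext <;> simp [hA]) (fun w => by ext <;> simp [hA])
  have he : HasFDerivAt f (e : _ →L[ℝ] _) u₀ := by
    have h2 : HasFDerivAt (fun u : (ℝ × E) × C(Icc (0 : ℝ) 1, E) => primitiveCLM E (N u.2))
        (fderiv ℝ (fun u : (ℝ × E) × C(Icc (0 : ℝ) 1, E) => primitiveCLM E (N u.2)) u₀) u₀ :=
      (((primitiveCLM E).contDiff.comp (hNs.comp contDiff_snd)).differentiable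
        (by simp)).differentiableAt.hasFDerivAt
    have h3 : HasFDerivAt (fun u : (ℝ × E) × C(Icc (0 : ℝ) 1, E) => u.1.1)
        ((ContinuousLinearMap.fst ℝ ℝ E).comp (.fst ℝ _ _)) u₀ :=
      ((ContinuousLinearMap.fst ℝ ℝ E).comp
        (.fst ℝ (ℝ × E) C(Icc (0 : ℝ) 1, E))).hasFDerivAt
    have h4 : HasFDerivAt (fun u : (ℝ × E) × C(Icc (0 : ℝ) 1, E) => cst u.1.2)
        (cst.comp ((ContinuousLinearMap.snd ℝ ℝ E).comp (.fst ℝ _ _))) u₀ :=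
      cst.hasFDerivAt.comp u₀ (hasFDerivAt_snd.comp u₀ hasFDerivAt_fst)
    have h5 := (hasFDerivAt_fst (𝕜 := ℝ) (p := u₀)).prodMk
      (((hasFDerivAt_snd (𝕜 := ℝ) (p := u₀)).sub h4).sub (h3.smul h2))
    refine h5.congr_fderiv ?_
    refine ContinuousLinearMap.ext fun w => ?_
    refine Prod.ext rfl ?_
    simp only [e, ContinuousLinearEquiv.coe_coe, ContinuousLinearEquiv.equivOfInverse_apply,
      ContinuousLinearMap.prod_apply, sub_apply, hA]
    simp [hu₀, hv, sub_sub]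
  have hfu₀ : f u₀ = ((0, x₀), 0) := by simp [hf, hu₀, hα₀]
  let H := (hfs.contDiffAt (x := u₀)).toOpenPartialHomeomorph f he (by simp)
  have hH : (H : _ → _) = f := (hfs.contDiffAt (x := u₀)).toOpenPartialHomeomorph_coe he (by simp)
  have hsrc : u₀ ∈ H.source :=
    (hfs.contDiffAt (x := u₀)).mem_toOpenPartialHomeomorph_source he (by simp)
  have htgt : ((0, x₀), 0) ∈ H.target := by
    have := H.map_source hsrc
    rwa [hH, hfu₀] at this
  have hsymm₀ : H.symm ((0, x₀), 0) = u₀ := by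
    rw [← hfu₀, ← hH]; exact H.left_inv hsrc
  let ι : ℝ × E → (ℝ × E) × C(Icc (0 : ℝ) 1, E) := fun p => (p, 0)
  have hι : ContDiff ℝ ∞ ι := contDiff_id.prodMk contDiff_const
  refine ⟨fun p => (H.symm (ι p)).2, by simp only [ι, hsymm₀]; rfl, ?_⟩
  have hιc : Tendsto ι (𝓝 (0, x₀)) (𝓝 ((0, x₀), 0)) := hι.continuous.tendsto _
  have hsc : Tendsto H.symm (𝓝 ((0, x₀), 0)) (𝓝 u₀) := by
    have := H.continuousAt_symm htgt
    rwa [ContinuousAt, hsymm₀] at this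
  -- the derivative stays invertible near `u₀`
  have hinv : ∀ᶠ u in 𝓝 u₀,
      fderiv ℝ f u ∈ range (ContinuousLinearEquiv.toContinuousLinearMap :
        (((ℝ × E) × C(Icc (0 : ℝ) 1, E)) ≃L[ℝ] ((ℝ × E) × C(Icc (0 : ℝ) 1, E))) → _) := by
    refine ((hfs.continuous_fderiv (by simp)).tendsto u₀).eventually ?_
    rw [he.fderiv]
    exact ContinuousLinearEquiv.nhds e
  filter_upwards [hιc.eventually (H.open_target.mem_nhds htgt),
    (hsc.comp hιc).eventually hinv] with p hp1 hp2
  obtain ⟨e', he'⟩ := hp2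
  constructor
  · have hd : HasFDerivAt H (e' : _ →L[ℝ] _) (H.symm (ι p)) := by
      rw [hH, he']
      exact (hfs.differentiable (by simp)).differentiableAt.hasFDerivAt
    have h1 : ContDiffAt ℝ ∞ H.symm (ι p) :=
      H.contDiffAt_symm hp1 hd (by rw [hH]; exact hfs.contDiffAt)
    exact contDiff_snd.contDiffAt.comp p (h1.comp p hι.contDiffAt)
  · have h1 : f (H.symm (ι p)) = ι p := by rw [← hH]; exact H.right_inv hp1
    have h2 : (H.symm (ι p)).1 = p := congrArg Prod.fst h1
    have h3 : (H.symm (ι p)).2 - cst (H.symm (ι p)).1.2 -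
      (H.symm (ι p)).1.1 • primitiveCLM E (N (H.symm (ι p)).2) = 0 := congrArg Prod.snd h1
    rw [h2, sub_sub, sub_eq_zero] at h3
    exact h3

section Flow

variable {E : Type u} [NormedAddCommGroup E] [NormedSpace ℝ E]

/-- There is a solution of `γ' = s X(γ)` on `[0, 1]` inside `M` that leads from `x` to `y`; in
other words, the time-`s` flow of `X` maps `x` to `y`. -/
def FlowsTo (X : E → E) (M : Set E) (s : ℝ) (x y : E) : Prop :=
  ∃ γ : ℝ → E, γ 0 = x ∧ γ 1 = y ∧
    ∀ t ∈ Icc (0 : ℝ) 1, γ t ∈ M ∧ HasDerivWithinAt γ (s • X (γ t)) (Icc 0 1) t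

variable {X : E → E} {M : Set E} {s : ℝ} {x y z : E}

lemma FlowsTo.mem_right (h : FlowsTo X M s x y) : y ∈ M := by
  obtain ⟨γ, -, rfl, h⟩ := h
  exact (h 1 (right_mem_Icc.2 zero_le_one)).1

lemma FlowsTo.zero (hx : x ∈ M) : FlowsTo X M 0 x x :=
  ⟨fun _ => x, rfl, rfl, fun t _ => ⟨hx, by simpa using hasDerivWithinAt_const t (Icc 0 1) x⟩⟩

lemma FlowsTo.symm (h : FlowsTo X M s x y) : FlowsTo X M (-s) y x := by
  obtain ⟨γ, h0, h1, h⟩ := h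
  refine ⟨fun t => γ (1 - t), by simpa using h1, by simpa using h0, fun t ht => ?_⟩
  have ht' : 1 - t ∈ Icc (0 : ℝ) 1 := ⟨by linarith [ht.2], by linarith [ht.1]⟩
  refine ⟨(h _ ht').1, ?_⟩
  have h2 := (h _ ht').2.scomp t (((hasDerivAt_id t).const_sub 1).hasDerivWithinAt (s := Icc 0 1))
    (fun τ hτ => ⟨sub_nonneg.2 hτ.2, sub_le_self 1 hτ.1⟩)
  simpa [Function.comp_def] using h2

/-- Along an integral curve, the point reached at time `t` is the value of the flow at the
rescaled time. -/
lemma FlowsTo.of_curve {γ : ℝ → E}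
    (h : ∀ t ∈ Icc (0 : ℝ) 1, γ t ∈ M ∧ HasDerivWithinAt γ (s • X (γ t)) (Icc 0 1) t)
    {t : ℝ} (ht : t ∈ Icc (0 : ℝ) 1) : FlowsTo X M (t * s) (γ 0) (γ t) := by
  refine ⟨fun τ => γ (τ * t), by simp, by simp, fun τ hτ => ?_⟩
  have hm : ∀ τ ∈ Icc (0 : ℝ) 1, τ * t ∈ Icc (0 : ℝ) 1 := fun τ hτ =>
    ⟨mul_nonneg hτ.1 ht.1, mul_le_one₀ hτ.2 ht.1 ht.2⟩
  refine ⟨(h _ (hm τ hτ)).1, ?_⟩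
  have h2 := (h _ (hm τ hτ)).2.scomp τ
    (((hasDerivAt_id τ).mul_const t).hasDerivWithinAt (s := Icc 0 1)) hm
  simpa [Function.comp_def, smul_smul] using h2

lemma FlowsTo.unique (hM : IsOpen M) (hX : ContDiffOn ℝ ∞ X M) (h : FlowsTo X M s x y)
    (h' : FlowsTo X M s x z) : y = z := by
  obtain ⟨γ, h0, rfl, h⟩ := h
  obtain ⟨γ', h0', rfl, h'⟩ := h'
  have hc : ContinuousOn γ (Icc 0 1) := fun t ht => (h t ht).2.continuousWithinAt
  have hc' : ContinuousOn γ' (Icc 0 1) := fun t ht => (h' t ht).2.continuousWithinAt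
  have hK : IsCompact (γ '' Icc 0 1 ∪ γ' '' Icc 0 1) :=
    (isCompact_Icc.image_of_continuousOn hc).union (isCompact_Icc.image_of_continuousOn hc')
  have hKM : γ '' Icc 0 1 ∪ γ' '' Icc 0 1 ⊆ M := by
    rintro _ (⟨t, ht, rfl⟩ | ⟨t, ht, rfl⟩)
    · exact (h t ht).1
    · exact (h' t ht).1
  have hsX : ContDiffOn ℝ ∞ (fun y => s • X y) M := contDiffOn_const.smul hX
  obtain ⟨C, hC⟩ := LocallyLipschitzOn.exists_lipschitzOnWith_of_compact
    (f := fun y => s • X y) hK (by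
      intro y hy
      obtain ⟨C, t, ht, hL⟩ := ((hsX.contDiffAt (hM.mem_nhds (hKM hy))).of_le
        (by simp)).exists_lipschitzOnWith
      exact ⟨C, t, mem_nhdsWithin_of_mem_nhds ht, hL⟩)
  have hIci : ∀ t ∈ Ico (0 : ℝ) 1, ∀ {η : ℝ → E} {η'},
      HasDerivWithinAt η η' (Icc 0 1) t → HasDerivWithinAt η η' (Ici t) t := fun t ht _ _ hd =>
    hd.mono_of_mem_nhdsWithin (mem_of_superset (Icc_mem_nhdsGE ht.2) (Icc_subset_Icc_left ht.1))
  exact ODE_solution_unique_of_mem_Icc_right (v := fun _ y => s • X y) (fun _ _ => hC) hc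
    (fun t ht => hIci t ht (h t (Ico_subset_Icc_self ht)).2)
    (fun t ht => Or.inl ⟨t, Ico_subset_Icc_self ht, rfl⟩) hc'
    (fun t ht => hIci t ht (h' t (Ico_subset_Icc_self ht)).2)
    (fun t ht => Or.inr ⟨t, Ico_subset_Icc_self ht, rfl⟩) (h0.trans h0'.symm)
    (right_mem_Icc.2 zero_le_one)

lemma FlowsTo.unique_left (hM : IsOpen M) (hX : ContDiffOn ℝ ∞ X M) (h : FlowsTo X M s x z)
    (h' : FlowsTo X M s y z) : x = y :=
  h.symm.unique hM hX h'.symm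

open Classical in
/-- The flow of `X` in `M` as a function of time and initial point; its value is the initial point
when the solution does not exist. -/
noncomputable def flowMap (X : E → E) (M : Set E) (p : ℝ × E) : E :=
  if h : ∃ y, FlowsTo X M p.1 p.2 y then h.choose else p.2

lemma FlowsTo.flowMap_eq (hM : IsOpen M) (hX : ContDiffOn ℝ ∞ X M) (h : FlowsTo X M s x y) :
    flowMap X M (s, x) = y := by
  have h' : ∃ y, FlowsTo X M (s, x).1 (s, x).2 y := ⟨y, h⟩
  rw [flowMap, dif_pos h']
  exact h'.choose_spec.unique hM hX h

variable [FiniteDimensional ℝ E]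

/-- Near a point, a map that is smooth on an open set agrees with one that is smooth everywhere. -/
lemma exists_contDiff_eqOn_ball (hM : IsOpen M) (hX : ContDiffOn ℝ ∞ X M) {x₀ : E} (hx₀ : x₀ ∈ M) :
    ∃ (ρ : ℝ) (Y : E → E), 0 < ρ ∧ ContDiff ℝ ∞ Y ∧ ∀ x ∈ Metric.ball x₀ ρ, x ∈ M ∧ Y x = X x := by
  obtain ⟨ρ, hρ, hball⟩ := Metric.nhds_basis_closedBall.mem_iff.1 (hM.mem_nhds hx₀)
  let χ : ContDiffBump x₀ := ⟨ρ / 2, ρ, by positivity, by linarith⟩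
  refine ⟨ρ / 2, fun x => χ x • X x, by positivity, ?_, fun x hx => ⟨?_, ?_⟩⟩
  · refine contDiff_iff_contDiffAt.2 fun x => ?_
    by_cases hx : x ∈ M
    · exact χ.contDiff.contDiffAt.smul (hX.contDiffAt (hM.mem_nhds hx))
    · have hx' : x ∉ tsupport χ := by rw [χ.tsupport_eq]; exact fun h => hx (hball h)
      have h0 : (fun x => χ x • X x) =ᶠ[𝓝 x] fun _ => 0 := by
        filter_upwards [notMem_tsupport_iff_eventuallyEq.1 hx'] with y hy
        simp [hy]
      exact contDiffAt_const.congr_of_eventuallyEq h0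
  · exact hball (Metric.ball_subset_closedBall (Metric.ball_subset_ball (by linarith) hx))
  · simp only [χ.one_of_mem_closedBall (Metric.ball_subset_closedBall hx), one_smul]

/-- The endpoint at time one of the solutions of the integral equation is the flow: for small times
they stay where the vector field agrees with its globally smooth modification. -/
theorem exists_smooth_flow (hM : IsOpen M) (hX : ContDiffOn ℝ ∞ X M) {x₀ : E} (hx₀ : x₀ ∈ M) :
    ∃ φ : ℝ × E → E, ∀ᶠ p in 𝓝 ((0 : ℝ), x₀),
      FlowsTo X M p.1 p.2 (φ p) ∧ ContDiffAt ℝ ∞ φ p := by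
  obtain ⟨ρ, Y, hρ, hY, hYX⟩ := exists_contDiff_eqOn_ball hM hX hx₀
  obtain ⟨S, hS0, hS⟩ := exists_contDiffAt_integral_solution hY x₀
  have hone : (1 : ℝ) ∈ Icc (0 : ℝ) 1 := right_mem_Icc.2 zero_le_one
  refine ⟨fun p => S p ⟨1, hone⟩, ?_⟩
  have hSc : Tendsto S (𝓝 (0, x₀)) (𝓝 (ContinuousMap.const _ x₀)) := by
    have := hS.self_of_nhds.1.continuousAt.tendsto
    rwa [hS0] at this
  filter_upwards [hS, hSc.eventually (Metric.ball_mem_nhds _ hρ)] with p hp hball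
  have hSt : ∀ t, S p t ∈ Metric.ball x₀ ρ := fun t =>
    (ContinuousMap.dist_apply_le_dist (g := ContinuousMap.const _ x₀) t).trans_lt hball
  constructor
  · let γ : ℝ → E := IccExtend (zero_le_one' ℝ) (S p)
    have hγc : Continuous γ := (S p).continuous.Icc_extend'
    have hγ : ∀ t ∈ Icc (0 : ℝ) 1, γ t = p.2 + p.1 • ∫ τ in (0 : ℝ)..t, Y (γ τ) := by
      intro t ht
      have h1 : γ t = S p ⟨t, ht⟩ := IccExtend_of_mem _ _ ht
      rw [h1, hp.2]
      rfl
    refine ⟨γ, ?_, IccExtend_of_mem _ _ hone, fun t ht => ?_⟩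
    · rw [hγ 0 (left_mem_Icc.2 zero_le_one)]; simp
    · have hb : γ t ∈ Metric.ball x₀ ρ := hSt _
      refine ⟨(hYX _ hb).1, ?_⟩
      rw [← (hYX _ hb).2]
      have hd := (((hY.continuous.comp hγc).integral_hasStrictDerivAt 0 t).hasDerivAt.const_smul
        p.1).const_add p.2
      exact hd.hasDerivWithinAt.congr_of_mem hγ ht
  · have : ContDiff ℝ ∞ fun α : C(Icc (0 : ℝ) 1, E) => α ⟨1, hone⟩ :=
      (ContinuousMap.evalCLM (M := E) ℝ (⟨1, hone⟩ : Icc (0 : ℝ) 1)).contDiff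
    exact this.contDiffAt.comp p hp.1

/-- Near time `0`, the flow is defined and smooth jointly in time and initial point. -/
theorem exists_nhds_flowMap (hM : IsOpen M) (hX : ContDiffOn ℝ ∞ X M) {x₀ : E} (hx₀ : x₀ ∈ M) :
    ∃ δ > 0, ∃ U, IsOpen U ∧ x₀ ∈ U ∧ U ⊆ M ∧ ∀ s ∈ Ioo (-δ) δ, ∀ x ∈ U,
      FlowsTo X M s x (flowMap X M (s, x)) ∧ ContDiffAt ℝ ∞ (flowMap X M) (s, x) := by
  obtain ⟨φ, hφ⟩ := exists_smooth_flow hM hX hx₀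
  have h1 : ∀ᶠ p in 𝓝 ((0 : ℝ), x₀),
      FlowsTo X M p.1 p.2 (flowMap X M p) ∧ ContDiffAt ℝ ∞ (flowMap X M) p := by
    filter_upwards [hφ.eventually_nhds] with p hp
    have heq : flowMap X M =ᶠ[𝓝 p] φ := hp.mono fun q hq => hq.1.flowMap_eq hM hX
    refine ⟨?_, hp.self_of_nhds.2.congr_of_eventuallyEq heq⟩
    rw [heq.self_of_nhds]
    exact hp.self_of_nhds.1
  rw [nhds_prod_eq, Filter.eventually_prod_iff] at h1
  obtain ⟨pa, ha, pb, hb, hab⟩ := h1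
  obtain ⟨δ, hδ, hball⟩ := Metric.eventually_nhds_iff_ball.1 ha
  obtain ⟨U, hU, hUo, hxU⟩ := eventually_nhds_iff.1 (hb.and (hM.mem_nhds hx₀))
  refine ⟨δ, hδ, U, hUo, hxU, fun x hx => (hU x hx).2,
    fun s hs x hx => hab (hball s ?_) (hU x hx).1⟩
  rwa [Real.ball_eq_Ioo, zero_sub, zero_add]

end Flow

section FlowDerivative

variable {E : Type u} [NormedAddCommGroup E] [NormedSpace ℝ E]
  {X : E → E} {M U : Set E} {δ : ℝ}

lemma flowMap_zero (hM : IsOpen M) (hX : ContDiffOn ℝ ∞ X M) {x : E} (hx : x ∈ M) :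
    flowMap X M (0, x) = x :=
  (FlowsTo.zero hx).flowMap_eq hM hX

theorem hasDerivAt_flowMap (hM : IsOpen M) (hX : ContDiffOn ℝ ∞ X M)
    (h : ∀ s ∈ Ioo (-δ) δ, ∀ x ∈ U,
      FlowsTo X M s x (flowMap X M (s, x)) ∧ ContDiffAt ℝ ∞ (flowMap X M) (s, x))
    {s : ℝ} (hs : s ∈ Ioo (-δ) δ) {x : E} (hx : x ∈ U) :
    HasDerivAt (fun σ => flowMap X M (σ, x)) (X (flowMap X M (s, x))) s := by
  have hδ : 0 < δ := by linarith [hs.1, hs.2]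
  -- reparametrising the integral curve that defines the flow at time `σ` covers the times `t * σ`
  have key : ∀ σ ∈ Ioo (-δ) δ, σ ≠ 0 → ∀ t ∈ Icc (0 : ℝ) 1, t * σ ∈ Ioo (-δ) δ →
      HasDerivAt (fun σ => flowMap X M (σ, x)) (X (flowMap X M (t * σ, x))) (t * σ) := by
    intro σ hσ hσ0 t ht htσ
    obtain ⟨γ, h0, -, hγ⟩ := (h σ hσ x hx).1
    have hφ : ∀ τ ∈ Icc (0 : ℝ) 1, flowMap X M (τ * σ, x) = γ τ := by
      intro τ hτ
      have := (FlowsTo.of_curve hγ hτ).flowMap_eq hM hX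
      rwa [h0] at this
    have hd : DifferentiableAt ℝ (fun σ => flowMap X M (σ, x)) (t * σ) :=
      ((h _ htσ x hx).2.comp (t * σ) (contDiffAt_id.prodMk contDiffAt_const)).differentiableAt
        (by simp)
    have h1 : HasDerivWithinAt γ (σ • deriv (fun σ => flowMap X M (σ, x)) (t * σ)) (Icc 0 1) t := by
      have h2 := hd.hasDerivAt.scomp t ((hasDerivAt_id t).mul_const σ)
      rw [one_mul] at h2
      exact h2.hasDerivWithinAt.congr (fun τ hτ => (hφ τ hτ).symm) (hφ t ht).symm
    have h3 := (uniqueDiffOn_Icc zero_lt_one t ht).eq_deriv (Icc (0 : ℝ) 1) h1 (hγ t ht).2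
    rw [hφ t ht, ← smul_right_injective E hσ0 h3]
    exact hd.hasDerivAt
  rcases eq_or_ne s 0 with rfl | hs0
  · have := key (δ / 2) ⟨by linarith, by linarith⟩ (by positivity) 0 (by simp) (by simpa using hδ)
    simpa using this
  · have := key s hs hs0 1 (by simp) (by simpa using hs)
    simpa using this

/-- The variational equation: the differential of the flow is transported by the derivative of
the vector field. -/
theorem hasDerivAt_fderiv_flowMap (hM : IsOpen M) (hX : ContDiffOn ℝ ∞ X M) (hU : IsOpen U)
    (h : ∀ s ∈ Ioo (-δ) δ, ∀ x ∈ U,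
      FlowsTo X M s x (flowMap X M (s, x)) ∧ ContDiffAt ℝ ∞ (flowMap X M) (s, x))
    {s : ℝ} (hs : s ∈ Ioo (-δ) δ) {x : E} (hx : x ∈ U) (v : E) :
    HasDerivAt (fun σ => fderiv ℝ (flowMap X M) (σ, x) (0, v))
      (fderiv ℝ X (flowMap X M (s, x)) (fderiv ℝ (flowMap X M) (s, x) (0, v))) s := by
  set φ := flowMap X M
  have hφ : ContDiffAt ℝ ∞ φ (s, x) := (h s hs x hx).2
  have hφ' : DifferentiableAt ℝ (fderiv ℝ φ) (s, x) :=
    (hφ.fderiv_right (m := 1) (by norm_cast)).differentiableAt (by simp)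
  have hsymm : fderiv ℝ (fderiv ℝ φ) (s, x) (1, 0) (0, v) =
      fderiv ℝ (fderiv ℝ φ) (s, x) (0, v) (1, 0) :=
    (hφ.isSymmSndFDerivAt (by
      rw [minSmoothness_of_isRCLikeNormedField]; exact WithTop.coe_le_coe.2 le_top)).eq _ _
  -- the time derivative of `φ` is `X ∘ φ`; it is differentiated in the direction `v`
  have h1 : ∀ y ∈ U, fderiv ℝ φ (s, y) (1, 0) = X (φ (s, y)) := by
    intro y hy
    have hd : HasFDerivAt φ (fderiv ℝ φ (s, y)) (s, y) :=
      ((h s hs y hy).2.differentiableAt (by simp)).hasFDerivAt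
    have h2 := hd.comp_hasDerivAt s ((hasDerivAt_id s).prodMk (hasDerivAt_const s y))
    exact h2.unique (hasDerivAt_flowMap hM hX h hs hy)
  have hpair : HasFDerivAt (fun y : E => (s, y)) (ContinuousLinearMap.inr ℝ ℝ E) x :=
    (hasFDerivAt_const s x).prodMk (hasFDerivAt_id x)
  have h2 : HasFDerivAt (fun y => fderiv ℝ φ (s, y) (1, 0))
      ((ContinuousLinearMap.apply ℝ E ((1 : ℝ), (0 : E))).comp
        ((fderiv ℝ (fderiv ℝ φ) (s, x)).comp (.inr ℝ ℝ E))) x :=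
    (ContinuousLinearMap.apply ℝ E ((1 : ℝ), (0 : E))).hasFDerivAt.comp x
      (hφ'.hasFDerivAt.comp x hpair)
  have hXd : DifferentiableAt ℝ X (φ (s, x)) :=
    (hX.contDiffAt (hM.mem_nhds (h s hs x hx).1.mem_right)).differentiableAt (by simp)
  have h3 : HasFDerivAt (fun y => X (φ (s, y)))
      ((fderiv ℝ X (φ (s, x))).comp ((fderiv ℝ φ (s, x)).comp (.inr ℝ ℝ E))) x :=
    hXd.hasFDerivAt.comp x ((hφ.differentiableAt (by simp)).hasFDerivAt.comp x hpair)
  have h4 := h2.unique (h3.congr_of_eventuallyEq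
    (Filter.eventuallyEq_of_mem (hU.mem_nhds hx) h1))
  have h5 : fderiv ℝ (fderiv ℝ φ) (s, x) (0, v) (1, 0) =
      fderiv ℝ X (φ (s, x)) (fderiv ℝ φ (s, x) (0, v)) := DFunLike.congr_fun h4 v
  rw [← h5, ← hsymm]
  exact (ContinuousLinearMap.apply ℝ E ((0 : ℝ), v)).hasFDerivAt.comp_hasDerivAt s
    (hφ'.hasFDerivAt.comp_hasDerivAt s ((hasDerivAt_id s).prodMk (hasDerivAt_const s x)))

/-- If a bilinear form is infinitesimally invariant under `X`, the flow of `X` preserves it. -/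
theorem bilin_fderiv_flowMap (hM : IsOpen M) (hX : ContDiffOn ℝ ∞ X M) (hU : IsOpen U)
    (hUM : U ⊆ M) (h : ∀ s ∈ Ioo (-δ) δ, ∀ x ∈ U,
      FlowsTo X M s x (flowMap X M (s, x)) ∧ ContDiffAt ℝ ∞ (flowMap X M) (s, x))
    (B : E →L[ℝ] E →L[ℝ] ℝ)
    (hB : ∀ x ∈ M, ∀ v w, B (fderiv ℝ X x v) w + B v (fderiv ℝ X x w) = 0)
    {s : ℝ} (hs : s ∈ Ioo (-δ) δ) {x : E} (hx : x ∈ U) (v w : E) :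
    B (fderiv ℝ (fun y => flowMap X M (s, y)) x v) (fderiv ℝ (fun y => flowMap X M (s, y)) x w)
      = B v w := by
  have hslice : ∀ σ ∈ Ioo (-δ) δ, ∀ v, fderiv ℝ (fun y => flowMap X M (σ, y)) x v =
      fderiv ℝ (flowMap X M) (σ, x) (0, v) := by
    intro σ hσ v
    have hpair : HasFDerivAt (fun y : E => (σ, y)) (ContinuousLinearMap.inr ℝ ℝ E) x :=
      (hasFDerivAt_const σ x).prodMk (hasFDerivAt_id x)
    have hd := ((h σ hσ x hx).2.differentiableAt (by simp)).hasFDerivAt.comp x hpair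
    exact DFunLike.congr_fun hd.fderiv v
  have h0 : (0 : ℝ) ∈ Ioo (-δ) δ := by constructor <;> linarith [hs.1, hs.2]
  have hinit : ∀ v, fderiv ℝ (flowMap X M) (0, x) (0, v) = v := by
    intro v
    rw [← hslice 0 h0 v]
    have : (fun y => flowMap X M (0, y)) =ᶠ[𝓝 x] fun y => y :=
      Filter.eventuallyEq_of_mem (hU.mem_nhds hx) fun y hy => flowMap_zero hM hX (hUM hy)
    rw [this.fderiv_eq]
    simp
  have hderiv : ∀ σ ∈ Ioo (-δ) δ, HasDerivAt (fun σ => B (fderiv ℝ (flowMap X M) (σ, x) (0, v))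
      (fderiv ℝ (flowMap X M) (σ, x) (0, w))) 0 σ := by
    intro σ hσ
    have hv := hasDerivAt_fderiv_flowMap hM hX hU h hσ hx v
    have hw := hasDerivAt_fderiv_flowMap hM hX hU h hσ hx w
    have := (B.hasFDerivAt.comp_hasDerivAt σ hv).clm_apply hw
    simpa only [Function.comp_apply, hB _ (h σ hσ x hx).1.mem_right] using this
  have hconst := isOpen_Ioo.is_const_of_deriv_eq_zero isPreconnected_Ioo
    (fun σ hσ => (hderiv σ hσ).differentiableAt.differentiableWithinAt)
    (fun σ hσ => (hderiv σ hσ).deriv) hs h0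
  rw [hslice s hs, hslice s hs, hconst, hinit, hinit]

end FlowDerivative

/-! ### Energy reparametrisation, remainder estimates and polynomial functions -/

open Asymptotics

/-- The local inverse of `f / g²`, extended smoothly to the whole line. -/
lemma exists_contDiff_inverse {f g : ℝ → ℝ} (hf : ContDiff ℝ ∞ f) (hg : ContDiff ℝ ∞ g)
    (hf0 : f 0 = 0) (hf1 : deriv f 0 = 1) (hg0 : g 0 = 1) :
    ∃ τ : ℝ → ℝ, ContDiff ℝ ∞ τ ∧ τ 0 = 0 ∧ deriv τ 0 = 1 ∧
      ∀ᶠ y in 𝓝 0, f (τ y) = y * g (τ y) ^ 2 := by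
  set F : ℝ → ℝ := fun h => f h / g h ^ 2 with hF
  have hFc : ∀ h, g h ≠ 0 → ContDiffAt ℝ ∞ F h := fun h hh =>
    hf.contDiffAt.div (hg.contDiffAt.pow 2) (pow_ne_zero 2 hh)
  have hg0' : g 0 ≠ 0 := by rw [hg0]; exact one_ne_zero
  have hF0 : F 0 = 0 := by simp [hF, hf0]
  have hF1 : HasDerivAt F 1 0 := by
    have h1 : HasDerivAt f 1 0 := by
      rw [← hf1]; exact (hf.differentiable (by simp)).differentiableAt.hasDerivAt
    have h2 : HasDerivAt g (deriv g 0) 0 :=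
      (hg.differentiable (by simp)).differentiableAt.hasDerivAt
    refine (h1.div (h2.pow 2) (pow_ne_zero 2 hg0')).congr_deriv ?_
    simp [hf0, hg0]
  have hF1' : HasFDerivAt F
      ((ContinuousLinearEquiv.unitsEquivAut ℝ 1 : ℝ ≃L[ℝ] ℝ) : ℝ →L[ℝ] ℝ) 0 := by
    refine hF1.hasFDerivAt.congr_fderiv ?_
    ext; simp
  let H := (hFc 0 hg0').toOpenPartialHomeomorph F hF1' (by simp)
  have hH : (H : ℝ → ℝ) = F := (hFc 0 hg0').toOpenPartialHomeomorph_coe hF1' (by simp)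
  have hsrc : (0 : ℝ) ∈ H.source :=
    (hFc 0 hg0').mem_toOpenPartialHomeomorph_source hF1' (by simp)
  have htgt : (0 : ℝ) ∈ H.target := by
    have := H.map_source hsrc
    rwa [hH, hF0] at this
  have hs0 : H.symm 0 = 0 := by
    conv_lhs => rw [← hF0, ← hH]
    exact H.left_inv hsrc
  have hsc : Tendsto H.symm (𝓝 0) (𝓝 0) := by
    have := H.continuousAt_symm htgt
    rwa [ContinuousAt, hs0] at this
  have hd0 : ∀ᶠ h in 𝓝 (0 : ℝ), deriv F h ≠ 0 := by
    have h1 : ContinuousAt (deriv F) 0 := by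
      have h := (((hFc 0 hg0').fderiv_right (m := 0) (by simp)).continuousAt).clm_apply
        (continuousAt_const (y := (1 : ℝ)))
      simpa only [fderiv_apply_one_eq_deriv] using h
    exact h1.eventually_ne (by rw [hF1.deriv]; exact one_ne_zero)
  have hgd : ∀ᶠ h in 𝓝 (0 : ℝ), g h ≠ 0 := hg.continuous.continuousAt.eventually_ne hg0'
  obtain ⟨V, hV, hVo, hV0⟩ := eventually_nhds_iff.1 ((hsc.eventually hd0).and
    ((hsc.eventually hgd).and (H.open_target.mem_nhds htgt)))
  have hsm : ContDiffOn ℝ ∞ H.symm V := fun y hy => by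
    obtain ⟨h1, h2, h3⟩ := hV y hy
    refine (H.contDiffAt_symm_deriv h1 h3 ?_ ?_).contDiffWithinAt
    · rw [hH]; exact ((hFc _ h2).differentiableAt (by simp)).hasDerivAt
    · rw [hH]; exact hFc _ h2
  obtain ⟨ρ, τ, hρ, hτ, hτs⟩ := exists_contDiff_eqOn_ball hVo hsm hV0
  have heq : τ =ᶠ[𝓝 0] H.symm :=
    Filter.eventuallyEq_of_mem (Metric.ball_mem_nhds 0 hρ) fun y hy => (hτs y hy).2
  refine ⟨τ, hτ, by rw [heq.self_of_nhds, hs0], ?_, ?_⟩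
  · rw [heq.deriv_eq]
    have := H.hasDerivAt_symm htgt one_ne_zero (by rw [hs0, hH]; exact hF1)
    simpa using this.deriv
  · filter_upwards [Metric.ball_mem_nhds (0 : ℝ) hρ] with y hy
    obtain ⟨hyV, hy2⟩ := hτs y hy
    obtain ⟨-, h2, h3⟩ := hV y hyV
    rw [hy2]
    have h4 : F (H.symm y) = y := by rw [← hH]; exact H.right_inv h3
    rw [hF] at h4
    exact (div_eq_iff (pow_ne_zero 2 h2)).1 h4

/-- Taylor's formula at `0` with remainder `O(y^n)`. -/
lemma isBigO_sub_taylor {γ : ℝ → ℝ} (hγ : ContDiff ℝ ∞ γ) (n : ℕ) :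
    (fun y => γ y - ∑ k ∈ Finset.range n, iteratedDeriv k γ 0 / k.factorial * y ^ k)
      =O[𝓝 0] fun y => y ^ n := by
  have h1 := (taylor_isLittleO_univ (x₀ := (0 : ℝ)) (n := n)
    (hγ.of_le (by exact_mod_cast le_top))).isBigO
  have h2 : (fun y : ℝ => iteratedDeriv n γ 0 / n.factorial * y ^ n) =O[𝓝 0] fun y => y ^ n :=
    (isBigO_refl _ _).const_mul_left _
  simp only [sub_zero] at h1
  refine (h1.add h2).congr_left fun y => ?_
  rw [taylor_within_apply, Finset.sum_range_succ]
  simp only [iteratedDerivWithin_univ, sub_zero, smul_eq_mul]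
  rw [Finset.sum_congr rfl fun k _ => show ((k.factorial : ℝ)⁻¹ * y ^ k) * iteratedDeriv k γ 0 =
    iteratedDeriv k γ 0 / k.factorial * y ^ k by ring]
  ring

/-- A function that vanishes at time `0` and whose time derivative is `O(s^m)` is `O(s^(m+1))`,
locally uniformly in the parameter. -/
lemma isBigO_pow_succ_of_hasDerivAt {E : Type*} [TopologicalSpace E] {F F' : ℝ × E → ℝ} {x₀ : E}
    {m : ℕ} (hd : ∀ᶠ p in 𝓝 ((0 : ℝ), x₀), HasDerivAt (fun s => F (s, p.2)) (F' p) p.1)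
    (h0 : ∀ᶠ x in 𝓝 x₀, F (0, x) = 0)
    (hO : F' =O[𝓝 (0, x₀)] fun p => p.1 ^ m) : F =O[𝓝 (0, x₀)] fun p => p.1 ^ (m + 1) := by
  obtain ⟨C, hC⟩ := hO.bound
  have h := hd.and hC
  rw [nhds_prod_eq, Filter.eventually_prod_iff] at h
  obtain ⟨pa, ha, pb, hb, hab⟩ := h
  obtain ⟨δ, hδ, hball⟩ := Metric.eventually_nhds_iff_ball.1 ha
  refine IsBigO.of_bound |C| ?_
  rw [nhds_prod_eq, Filter.eventually_prod_iff]
  refine ⟨_, Metric.ball_mem_nhds (0 : ℝ) hδ, _, hb.and h0, fun {s} hs {x} hx => ?_⟩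
  have hs' : |s| < δ := by simpa using hs
  have hmem : ∀ σ ∈ Icc (-|s|) |s|, σ ∈ Metric.ball (0 : ℝ) δ := fun σ hσ => by
    rw [mem_ball_zero_iff, Real.norm_eq_abs]
    exact (abs_le.2 hσ).trans_lt hs'
  have hbound : ∀ σ ∈ Icc (-|s|) |s|, ‖F' (σ, x)‖ ≤ |C| * |s| ^ m := fun σ hσ => by
    refine ((hab (hball σ (hmem σ hσ)) hx.1).2).trans ?_
    rw [norm_pow, Real.norm_eq_abs]
    exact mul_le_mul (le_abs_self C) (pow_le_pow_left₀ (abs_nonneg σ) (abs_le.2 hσ) m)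
      (by positivity) (abs_nonneg C)
  have hmv := (convex_Icc (-|s|) |s|).norm_image_sub_le_of_norm_hasDerivWithin_le
    (f := fun σ => F (σ, x)) (f' := fun σ => F' (σ, x))
    (fun σ hσ => (hab (hball σ (hmem σ hσ)) hx.1).1.hasDerivWithinAt) hbound
    (show (0 : ℝ) ∈ Icc (-|s|) |s| by simp) (show s ∈ Icc (-|s|) |s| from abs_le.1 le_rfl)
  simp only [hx.2, sub_zero] at hmv
  refine hmv.trans (le_of_eq ?_)
  simp only [norm_pow, Real.norm_eq_abs]
  ring

section EvalDerivative

variable {E : Type*} [NormedAddCommGroup E] [NormedSpace ℝ E] {σ : Type*}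

lemma hasFDerivAt_mvPolynomial_eval [Fintype σ] {o : E → σ → ℝ} {o' : σ → E →L[ℝ] ℝ} {x : E}
    (ho : ∀ i, HasFDerivAt (fun y => o y i) (o' i) x) (P : MvPolynomial σ ℝ) :
    HasFDerivAt (fun y => MvPolynomial.eval (o y) P)
      (∑ i, MvPolynomial.eval (o x) (MvPolynomial.pderiv i P) • o' i) x := by
  classical
  induction P using MvPolynomial.induction_on with
  | C a => simpa using hasFDerivAt_const a x
  | add P Q hP hQ =>
    simp only [map_add, add_smul, Finset.sum_add_distrib]
    exact hP.add hQ
  | mul_X P j hP =>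
    have h := hP.mul (ho j)
    simp only [map_mul, MvPolynomial.eval_X]
    refine h.congr_fderiv ?_
    simp only [Derivation.leibniz, MvPolynomial.pderiv_X, smul_eq_mul, map_add, map_mul,
      MvPolynomial.eval_X, add_smul, Finset.sum_add_distrib, Finset.smul_sum, smul_smul]
    congr 1
    rw [Finset.sum_eq_single j (fun i _ hi => by simp [Pi.single_eq_of_ne' hi]) (by simp)]
    simp

lemma contDiffAt_mvPolynomial_eval {o : E → σ → ℝ} {x : E}
    (ho : ∀ i, ContDiffAt ℝ ∞ (fun y => o y i) x) (P : MvPolynomial σ ℝ) :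
    ContDiffAt ℝ ∞ (fun y => MvPolynomial.eval (o y) P) x := by
  induction P using MvPolynomial.induction_on with
  | C a => simpa using contDiffAt_const
  | add P Q hP hQ => simpa using hP.add hQ
  | mul_X P j hP => simpa using hP.mul (ho j)

end EvalDerivative

namespace PNKepler

open MvPolynomial

/-! ### Generators, their Hamiltonian vector fields and Poisson brackets -/

/-- Post-Newtonian polynomials: real polynomials in three variables, standing for the Kepler
Hamiltonian, `p_r²` and `1 / r`. All three have weight one. The momentum enters through
`p² = 2 (H_Kep + 1 / r)`. -/
abbrev PNPoly : Type := MvPolynomial (Fin 3) ℝ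

/-- The values of `H_Kep`, `p_r²` and `1 / r` at a point of phase space. -/
noncomputable def obs {d : ℕ} (x : PhaseSpace d) : Fin 3 → ℝ :=
  ![keplerHamiltonian x, radialMomentum x ^ 2, 1 / radius x]

/-- The generator `(p · q) Λ`. -/
noncomputable def generator {d : ℕ} (Λ : PNPoly) (x : PhaseSpace d) : ℝ :=
  pDotQ x * eval (obs x) Λ

/-- The Hamiltonian vector field of `(p · q) Λ`, written out. -/
noncomputable def generatorField {d : ℕ} (Λ : PNPoly) (x : PhaseSpace d) : PhaseSpace d :=
  (eval (obs x) (Λ + 2 * X 1 * pderiv 1 Λ) • x.1 + (pDotQ x * eval (obs x) (pderiv 0 Λ)) • x.2,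
    -(eval (obs x) (Λ + 2 * X 1 * pderiv 1 Λ) • x.2) +
      (pDotQ x * eval (obs x) (X 2 ^ 2 * (X 2 * (pderiv 2 Λ - pderiv 0 Λ) +
        2 * X 1 * pderiv 1 Λ))) • x.1)

/-- The derivation `P ↦ {P, (p · q) Λ}` of the polynomials in `H_Kep`, `p_r²`, `1 / r`, that is, the
derivative of the observable `P` along the Hamiltonian vector field of `(p · q) Λ`. It is given by
its values on the three variables, where `p²` is replaced by `2 (H_Kep + 1 / r)`. -/
noncomputable def bracket (Λ : PNPoly) : Derivation ℝ PNPoly PNPoly :=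
  mkDerivation ℝ ![
    -(2 * X 0 + X 2) * Λ
      + X 1 * (X 2 * pderiv 2 Λ - 2 * (2 * X 0 + X 2 - X 1) * pderiv 1 Λ),
    2 * X 1 * (-Λ + (2 * X 0 + X 2 - X 1) * pderiv 0 Λ + X 2 * pderiv 2 Λ),
    -X 2 * (Λ + X 1 * pderiv 0 Λ + 2 * X 1 * pderiv 1 Λ)]

/-- The symplectic form as a continuous bilinear form. -/
noncomputable def symplecticCLM (d : ℕ) : PhaseSpace d →L[ℝ] PhaseSpace d →L[ℝ] ℝ :=
  (innerSL ℝ).bilinearComp (.snd ℝ _ _) (.fst ℝ _ _) -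
    (innerSL ℝ).bilinearComp (.fst ℝ _ _) (.snd ℝ _ _)

variable {d : ℕ}

lemma symplecticCLM_apply (v w : PhaseSpace d) : symplecticCLM d v w = symplecticForm v w := rfl

lemma symplecticForm_swap (v w : PhaseSpace d) : symplecticForm v w = -symplecticForm w v := by
  simp only [symplecticForm, real_inner_comm]
  ring

lemma isOpen_puncturedPhaseSpace : IsOpen (puncturedPhaseSpace d) :=
  isOpen_ne.preimage continuous_fst

/-- A derivative of the form `w ↦ -ω(v, w)` determines the Hamiltonian vector as `v`. -/
lemma hamiltonianVectorField_eq {G : PhaseSpace d → ℝ} {x v : PhaseSpace d}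
    (h : HasFDerivAt G (-symplecticCLM d v) x) : hamiltonianVectorField G x = v := by
  have h1 : HasFDerivAt (fun p : EuclideanSpace ℝ (Fin d) => (x.1, p))
      (ContinuousLinearMap.inr ℝ (EuclideanSpace ℝ (Fin d)) (EuclideanSpace ℝ (Fin d))) x.2 :=
    (hasFDerivAt_const x.1 x.2).prodMk (hasFDerivAt_id x.2)
  have h2 : HasFDerivAt (fun q : EuclideanSpace ℝ (Fin d) => (q, x.2))
      (ContinuousLinearMap.inl ℝ (EuclideanSpace ℝ (Fin d)) (EuclideanSpace ℝ (Fin d))) x.1 :=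
    (hasFDerivAt_id x.1).prodMk (hasFDerivAt_const x.2 x.1)
  have h3 : HasGradientAt (fun p => G (x.1, p)) v.1 x.2 := by
    rw [hasGradientAt_iff_hasFDerivAt]
    refine (h.comp x.2 h1).congr_fderiv (ContinuousLinearMap.ext fun w => ?_)
    simp [symplecticCLM_apply, symplecticForm]
  have h4 : HasGradientAt (fun q => G (q, x.2)) (-v.2) x.1 := by
    rw [hasGradientAt_iff_hasFDerivAt]
    refine (h.comp x.1 h2).congr_fderiv (ContinuousLinearMap.ext fun w => ?_)
    simp [symplecticCLM_apply, symplecticForm]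
  rw [hamiltonianVectorField, h3.gradient, h4.gradient, neg_neg]

lemma hasFDerivAt_pDotQ (x : PhaseSpace d) :
    HasFDerivAt pDotQ (-symplecticCLM d (x.1, -x.2)) x := by
  have h := (hasFDerivAt_snd (𝕜 := ℝ) (p := x)).inner ℝ (hasFDerivAt_fst (𝕜 := ℝ) (p := x))
  refine h.congr_fderiv (ContinuousLinearMap.ext fun w => ?_)
  simp [symplecticCLM_apply, symplecticForm, real_inner_comm, add_comm]

lemma hasFDerivAt_momentumSq (x : PhaseSpace d) :
    HasFDerivAt momentumSq (-symplecticCLM d ((2 : ℝ) • x.2, 0)) x := by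
  have h := (hasFDerivAt_snd (𝕜 := ℝ) (p := x)).norm_sq
  refine h.congr_fderiv (ContinuousLinearMap.ext fun w => ?_)
  simp [symplecticCLM_apply, symplecticForm, inner_smul_left]

lemma hasFDerivAt_inv_radius {x : PhaseSpace d} (hx : x ∈ puncturedPhaseSpace d) :
    HasFDerivAt (fun y : PhaseSpace d => 1 / radius y)
      (-symplecticCLM d (0, ((1 / radius x) ^ 3) • x.1)) x := by
  have hr : ‖x.1‖ ≠ 0 := norm_ne_zero_iff.2 hx
  have h1 : HasFDerivAt (fun y : PhaseSpace d => ‖y.1‖ ^ 2) _ x :=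
    (hasFDerivAt_fst (𝕜 := ℝ) (p := x)).norm_sq
  have h2 := h1.sqrt (pow_ne_zero 2 hr)
  have h3 := (hasDerivAt_inv (x := √(‖x.1‖ ^ 2))
    (by rwa [Real.sqrt_sq (norm_nonneg _)])).comp_hasFDerivAt x h2
  have h4 : (fun y : PhaseSpace d => 1 / radius y) =
      Inv.inv ∘ fun y : PhaseSpace d => √(‖y.1‖ ^ 2) := by
    ext y
    simp [radius]
  rw [h4]
  refine h3.congr_fderiv (ContinuousLinearMap.ext fun w => ?_)
  simp [symplecticCLM_apply, symplecticForm, inner_smul_left, radius]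
  field_simp

/-- The Hamiltonian vectors of the observables `H_Kep`, `p_r²` and `1 / r`. -/
noncomputable def obsVector (x : PhaseSpace d) : Fin 3 → PhaseSpace d :=
  ![(x.2, -((1 / radius x) ^ 3 • x.1)),
    (2 * pDotQ x * (1 / radius x) ^ 2) • (x.1, -x.2) +
      (2 * pDotQ x ^ 2 * (1 / radius x)) • (0, (1 / radius x) ^ 3 • x.1),
    (0, (1 / radius x) ^ 3 • x.1)]

lemma hasFDerivAt_obs {x : PhaseSpace d} (hx : x ∈ puncturedPhaseSpace d) (i : Fin 3) :
    HasFDerivAt (fun y => obs y i) (-symplecticCLM d (obsVector x i)) x := by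
  have hc := hasFDerivAt_inv_radius hx
  fin_cases i
  · have h : HasFDerivAt (fun y : PhaseSpace d => (1 / 2 : ℝ) * momentumSq y - 1 / radius y) _ x :=
      ((hasFDerivAt_momentumSq x).const_mul (1 / 2)).sub hc
    refine (h.congr_of_eventuallyEq (Eventually.of_forall fun y => ?_)).congr_fderiv
      (ContinuousLinearMap.ext fun w => ?_)
    · simp only [obs, keplerHamiltonian, Fin.zero_eta, Matrix.cons_val_zero]
      ring
    · simp [obsVector, symplecticCLM_apply, symplecticForm, inner_smul_left]
  · have h : HasFDerivAt (fun y : PhaseSpace d => (pDotQ y * (1 / radius y)) ^ 2) _ x :=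
      ((hasFDerivAt_pDotQ x).mul hc).pow 2
    refine (h.congr_of_eventuallyEq (Eventually.of_forall fun y => ?_)).congr_fderiv
      (ContinuousLinearMap.ext fun w => ?_)
    · simp [obs, radialMomentum, div_eq_mul_inv]
    · simp [obsVector, symplecticCLM_apply, symplecticForm, inner_smul_left, inner_add_left]
      ring
  · exact hc

lemma contDiffAt_obs {x : PhaseSpace d} (hx : x ∈ puncturedPhaseSpace d) (i : Fin 3) :
    ContDiffAt ℝ ∞ (fun y => obs y i) x := by
  have hr : ContDiffAt ℝ ∞ (fun y : PhaseSpace d => radius y) x := contDiffAt_fst.norm ℝ hx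
  have hr0 : radius x ≠ 0 := norm_ne_zero_iff.2 hx
  have hm : ContDiffAt ℝ ∞ (fun y : PhaseSpace d => momentumSq y) x := contDiffAt_snd.norm_sq ℝ
  have hs : ContDiffAt ℝ ∞ (fun y : PhaseSpace d => pDotQ y) x :=
    contDiffAt_snd.inner ℝ contDiffAt_fst
  have hc : ContDiffAt ℝ ∞ (fun y : PhaseSpace d => 1 / radius y) x := contDiffAt_const.div hr hr0
  fin_cases i
  · exact (hm.div_const 2).sub hc
  · exact (hs.div hr hr0).pow 2
  · exact hc

lemma contDiffOn_generator (Λ : PNPoly) :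
    ContDiffOn ℝ ∞ (generator (d := d) Λ) (puncturedPhaseSpace d) := fun _ hx =>
  ((contDiffAt_snd.inner ℝ contDiffAt_fst).mul
    (contDiffAt_mvPolynomial_eval (contDiffAt_obs hx) Λ)).contDiffWithinAt

lemma contDiffOn_generatorField (Λ : PNPoly) :
    ContDiffOn ℝ ∞ (generatorField (d := d) Λ) (puncturedPhaseSpace d) := by
  intro x hx
  have he := fun P => contDiffAt_mvPolynomial_eval (contDiffAt_obs hx) P
  have hs : ContDiffAt ℝ ∞ (fun y : PhaseSpace d => pDotQ y) x :=
    contDiffAt_snd.inner ℝ contDiffAt_fst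
  exact ((((he _).smul contDiffAt_fst).add ((hs.mul (he _)).smul contDiffAt_snd)).prodMk
    (((he _).smul contDiffAt_snd).neg.add ((hs.mul (he _)).smul contDiffAt_fst))).contDiffWithinAt

lemma obs_one (x : PhaseSpace d) : obs x 1 = pDotQ x ^ 2 * obs x 2 ^ 2 := by
  simp [obs, radialMomentum, div_eq_mul_inv, mul_pow]

/-- `generatorField Λ` is the Hamiltonian vector field of `(p · q) Λ`. -/
lemma hasFDerivAt_generator (Λ : PNPoly) {x : PhaseSpace d} (hx : x ∈ puncturedPhaseSpace d) :
    HasFDerivAt (generator Λ) (-symplecticCLM d (generatorField Λ x)) x := by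
  have h : HasFDerivAt (fun y => pDotQ y * eval (obs y) Λ) _ x :=
    (hasFDerivAt_pDotQ x).mul (hasFDerivAt_mvPolynomial_eval (hasFDerivAt_obs hx) Λ)
  refine h.congr_fderiv (ContinuousLinearMap.ext fun w => ?_)
  have h2 : 1 / radius x = obs x 2 := rfl
  simp only [Fin.sum_univ_three, obsVector, generatorField, h2, Matrix.cons_val_zero,
    Matrix.cons_val_one, Matrix.cons_val_two]
  simp [symplecticCLM_apply, symplecticForm, inner_smul_left, inner_add_left, obs_one]
  ring

lemma bracket_apply (Λ P : PNPoly) :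
    bracket Λ P = ∑ i, pderiv i P * bracket Λ (X i) := by
  have h : bracket Λ = bracket Λ (X 0) • pderiv 0 + bracket Λ (X 1) • pderiv 1 +
      bracket Λ (X 2) • pderiv 2 := by
    refine derivation_ext fun j => ?_
    fin_cases j <;> simp [pderiv_X]
  conv_lhs => rw [h]
  simp [Fin.sum_univ_three, mul_comm]

/-- The derivatives of the three basic observables along the field of `(p · q) Λ`. They are
polynomials in the same observables because `p · q` enters only through `(p · q)² = r² p_r²`. -/
lemma obsVector_generatorField (Λ : PNPoly) {x : PhaseSpace d} (hx : x ∈ puncturedPhaseSpace d)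
    (i : Fin 3) :
    (-symplecticCLM d (obsVector x i)) (generatorField Λ x) = eval (obs x) (bracket Λ (X i)) := by
  have h2 : (radius x)⁻¹ = obs x 2 := (one_div _).symm
  have hr0 : radius x ≠ 0 := norm_ne_zero_iff.2 hx
  -- the relations that express the inner products by the three observables and `p · q`
  have hqq : ‖x.1‖ ^ 2 * obs x 2 ^ 2 = 1 := by
    rw [← h2]
    change radius x ^ 2 * (radius x)⁻¹ ^ 2 = 1
    field_simp
  have hpp : ‖x.2‖ ^ 2 = 2 * (obs x 0 + obs x 2) := by
    change momentumSq x = 2 * (momentumSq x / 2 - 1 / radius x + 1 / radius x)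
    ring
  have hpq : inner ℝ x.2 x.1 = pDotQ x := rfl
  have hqp : inner ℝ x.1 x.2 = pDotQ x := real_inner_comm _ _
  rw [bracket, mkDerivation_X]
  fin_cases i <;>
  simp [obsVector, generatorField, symplecticCLM_apply, symplecticForm, inner_smul_left,
    inner_smul_right, inner_add_left, inner_add_right, hpp, hpq, hqp, obs_one, h2]
  · linear_combination (eval (obs x) Λ + 2 * (pDotQ x ^ 2 * obs x 2 ^ 2) *
      eval (obs x) (pderiv 1 Λ)) * obs x 2 * hqq
  · linear_combination 2 * pDotQ x ^ 2 * obs x 2 ^ 2 * (obs x 2 *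
      (eval (obs x) (pderiv 2 Λ) - eval (obs x) (pderiv 0 Λ)) - eval (obs x) Λ) * hqq
  · linear_combination -(eval (obs x) Λ + 2 * (pDotQ x ^ 2 * obs x 2 ^ 2) *
      eval (obs x) (pderiv 1 Λ)) * obs x 2 * hqq

lemma fderiv_eval_obs_generatorField (Λ P : PNPoly) {x : PhaseSpace d}
    (hx : x ∈ puncturedPhaseSpace d) :
    fderiv ℝ (fun y => eval (obs y) P) x (generatorField Λ x) = eval (obs x) (bracket Λ P) := by
  rw [(hasFDerivAt_mvPolynomial_eval (hasFDerivAt_obs hx) P).fderiv, bracket_apply, map_sum]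
  simp only [map_mul, ← obsVector_generatorField Λ hx, sum_apply, smul_apply, smul_eq_mul]

/-- Hamiltonian vector fields leave the symplectic form infinitesimally invariant: their derivative
is, up to the symplectic form, the second derivative of the generator, which is symmetric. -/
lemma symplecticCLM_fderiv_generatorField (Λ : PNPoly) {x : PhaseSpace d}
    (hx : x ∈ puncturedPhaseSpace d) (v w : PhaseSpace d) :
    symplecticCLM d (fderiv ℝ (generatorField Λ) x v) w +
      symplecticCLM d v (fderiv ℝ (generatorField Λ) x w) = 0 := by
  have hG : ContDiffAt ℝ ∞ (generator Λ) x :=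
    (contDiffOn_generator Λ).contDiffAt (isOpen_puncturedPhaseSpace.mem_nhds hx)
  have hF : HasFDerivAt (generatorField Λ) (fderiv ℝ (generatorField Λ) x) x :=
    (((contDiffOn_generatorField Λ).contDiffAt
      (isOpen_puncturedPhaseSpace.mem_nhds hx)).differentiableAt (by simp)).hasFDerivAt
  have h1 : fderiv ℝ (generator Λ) =ᶠ[𝓝 x] fun y => -symplecticCLM d (generatorField Λ y) :=
    Filter.eventuallyEq_of_mem (isOpen_puncturedPhaseSpace.mem_nhds hx)
      fun y hy => (hasFDerivAt_generator Λ hy).fderiv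
  have h2 : ∀ u u', fderiv ℝ (fderiv ℝ (generator Λ)) x u u' =
      -symplecticCLM d (fderiv ℝ (generatorField Λ) x u) u' := by
    intro u u'
    have h5 : HasFDerivAt (fun y => -symplecticCLM d (generatorField Λ y)) _ x :=
      ((symplecticCLM d).hasFDerivAt.comp x hF).neg
    rw [h1.fderiv_eq, h5.fderiv]
    rfl
  have h3 : fderiv ℝ (fderiv ℝ (generator Λ)) x v w = fderiv ℝ (fderiv ℝ (generator Λ)) x w v :=
    (hG.isSymmSndFDerivAt (by
      rw [minSmoothness_of_isRCLikeNormedField]; exact WithTop.coe_le_coe.2 le_top)).eq _ _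
  rw [h2, h2] at h3
  have h4 : symplecticCLM d v (fderiv ℝ (generatorField Λ) x w) =
      -symplecticCLM d (fderiv ℝ (generatorField Λ) x w) v := symplecticForm_swap _ _
  linarith

/-- Flowing for time `s` along the field of `(p · q) Λ` is the Lie transform with generator
`s (p · q) Λ`. -/
lemma timeOneFlow_of_flowsTo {Λ : PNPoly} {s : ℝ} {x y : PhaseSpace d} {G : PhaseSpace d → ℝ}
    (hG : ∀ y ∈ puncturedPhaseSpace d, G y = generator Λ y)
    (h : FlowsTo (generatorField Λ) (puncturedPhaseSpace d) s x y) :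
    TimeOneFlow (fun y => s * G y) x y := by
  obtain ⟨γ, h0, h1, h⟩ := h
  refine ⟨γ, h0, h1, fun t ht => ⟨(h t ht).1, ?_⟩⟩
  have hd : HasFDerivAt (fun y => s * G y)
      (-symplecticCLM d (s • generatorField Λ (γ t))) (γ t) := by
    have h2 := ((hasFDerivAt_generator Λ (h t ht).1).congr_of_eventuallyEq
      (Filter.eventuallyEq_of_mem (isOpen_puncturedPhaseSpace.mem_nhds (h t ht).1) hG)).const_mul s
    refine h2.congr_fderiv ?_
    rw [map_smul, smul_neg]
  rw [hamiltonianVectorField_eq hd]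
  exact (h t ht).2

/-! ### Asymptotic expansions in the small parameter -/

/-- The function `F (ε, x)` has the expansion `∑ ε^k S_k(x)` up to order `ε^n`, uniformly near
`ε = 0`, `x = x₀`; the coefficients are post-Newtonian polynomials. -/
def HasExpansion (n : ℕ) (x₀ : PhaseSpace d) (F : ℝ × PhaseSpace d → ℝ) (S : PowerSeries PNPoly) :
    Prop :=
  (fun p : ℝ × PhaseSpace d =>
    F p - ∑ k ∈ Finset.range n, p.1 ^ k * eval (obs p.2) (PowerSeries.coeff k S))
    =O[𝓝 (0, x₀)] fun p => p.1 ^ n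

variable {n : ℕ} {x₀ : PhaseSpace d} {F G : ℝ × PhaseSpace d → ℝ} {S T : PowerSeries PNPoly}

lemma isBigO_eval_obs (hx₀ : x₀ ∈ puncturedPhaseSpace d) (P : PNPoly) :
    (fun p : ℝ × PhaseSpace d => eval (obs p.2) P) =O[𝓝 ((0 : ℝ), x₀)] fun _ => (1 : ℝ) :=
  ((contDiffAt_mvPolynomial_eval (contDiffAt_obs hx₀) P).continuousAt.tendsto.comp
    (continuous_snd.tendsto ((0 : ℝ), x₀))).isBigO_one ℝ

lemma isBigO_pow_of_le {x₀ : PhaseSpace d} {m n : ℕ} (h : m ≤ n) :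
    (fun p : ℝ × PhaseSpace d => p.1 ^ n) =O[𝓝 ((0 : ℝ), x₀)] fun p => p.1 ^ m := by
  obtain ⟨k, rfl⟩ := Nat.exists_eq_add_of_le h
  have h1 : (fun p : ℝ × PhaseSpace d => p.1 ^ k) =O[𝓝 ((0 : ℝ), x₀)] fun _ => (1 : ℝ) :=
    ((continuous_fst.pow k).tendsto ((0 : ℝ), x₀)).isBigO_one ℝ
  simpa [pow_add] using (isBigO_refl (fun p : ℝ × PhaseSpace d => p.1 ^ m) _).mul h1

lemma HasExpansion.mono (hx₀ : x₀ ∈ puncturedPhaseSpace d) {m : ℕ} (hmn : m ≤ n)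
    (h : HasExpansion n x₀ F S) : HasExpansion m x₀ F S := by
  obtain ⟨k, rfl⟩ := Nat.exists_eq_add_of_le hmn
  have h1 : (fun p : ℝ × PhaseSpace d => ∑ j ∈ Finset.range k,
      p.1 ^ (m + j) * eval (obs p.2) (S.coeff (m + j))) =O[𝓝 (0, x₀)] fun p => p.1 ^ m := by
    refine IsBigO.fun_sum fun j _ => ?_
    simpa using (isBigO_pow_of_le (Nat.le_add_right m j)).mul (isBigO_eval_obs hx₀ _)
  refine ((h.trans (isBigO_pow_of_le hmn)).add h1).congr_left fun p => ?_
  rw [Finset.sum_range_add]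
  ring

lemma HasExpansion.add (hF : HasExpansion n x₀ F S) (hG : HasExpansion n x₀ G T) :
    HasExpansion n x₀ (fun p => F p + G p) (S + T) := by
  refine (IsBigO.add hF hG).congr_left fun p => ?_
  simp only [map_add, mul_add, Finset.sum_add_distrib]
  ring

lemma HasExpansion.isBigO_one (hx₀ : x₀ ∈ puncturedPhaseSpace d) (h : HasExpansion n x₀ F S) :
    F =O[𝓝 (0, x₀)] fun _ => (1 : ℝ) := by
  simpa [HasExpansion] using h.mono hx₀ (Nat.zero_le n)

lemma hasExpansion_eval (n : ℕ) (hx₀ : x₀ ∈ puncturedPhaseSpace d) (P : PNPoly) :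
    HasExpansion n x₀ (fun p => eval (obs p.2) P) (PowerSeries.C P) := by
  cases n with
  | zero => simpa [HasExpansion] using isBigO_eval_obs hx₀ P
  | succ n =>
    refine (isBigO_zero _ _).congr_left fun p => ?_
    rw [Finset.sum_eq_single 0 (fun k _ hk => by simp [PowerSeries.coeff_C, hk]) (by simp)]
    simp

/-- If the coefficients of an expansion themselves depend on `ε` and have expansions, then the
double series may be rearranged by powers of `ε`. -/
lemma HasExpansion.double (hx₀ : x₀ ∈ puncturedPhaseSpace d) {f : ℕ → ℝ × PhaseSpace d → ℝ}
    {Q : ℕ → PowerSeries PNPoly}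
    (hF : (fun p => F p - ∑ m ∈ Finset.range n, p.1 ^ m * f m p) =O[𝓝 (0, x₀)] fun p => p.1 ^ n)
    (hf : ∀ m, HasExpansion n x₀ (f m) (Q m)) :
    HasExpansion n x₀ F
      (PowerSeries.mk fun k => ∑ q ∈ Finset.HasAntidiagonal.antidiagonal k, (Q q.1).coeff q.2) := by
  have h1 : (fun p : ℝ × PhaseSpace d => ∑ m ∈ Finset.range n, p.1 ^ m * (f m p -
      ∑ l ∈ Finset.range (n - m), p.1 ^ l * eval (obs p.2) ((Q m).coeff l)))
      =O[𝓝 (0, x₀)] fun p => p.1 ^ n := by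
    refine IsBigO.fun_sum fun m hm => ?_
    have h2 := (isBigO_refl (fun p : ℝ × PhaseSpace d => p.1 ^ m) (𝓝 (0, x₀))).mul
      ((hf m).mono hx₀ (Nat.sub_le n m))
    refine h2.congr_right fun p => ?_
    rw [← pow_add, Nat.add_sub_cancel' (Finset.mem_range.1 hm).le]
  refine (hF.add h1).congr_left fun p => ?_
  have h3 : ∑ k ∈ Finset.range n, p.1 ^ k * eval (obs p.2)
        (∑ q ∈ Finset.HasAntidiagonal.antidiagonal k, (Q q.1).coeff q.2) =
      ∑ m ∈ Finset.range n, p.1 ^ m *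
        ∑ l ∈ Finset.range (n - m), p.1 ^ l * eval (obs p.2) ((Q m).coeff l) := by
    simp only [Finset.mul_sum, map_sum]
    rw [← Finset.sum_range_diag_flip n
      fun m l => p.1 ^ m * (p.1 ^ l * eval (obs p.2) ((Q m).coeff l))]
    refine Finset.sum_congr rfl fun k _ => ?_
    rw [Finset.Nat.sum_antidiagonal_eq_sum_range_succ_mk]
    refine Finset.sum_congr rfl fun m hm => ?_
    rw [← mul_assoc, ← pow_add, Nat.add_sub_cancel' (Finset.mem_range_succ_iff.1 hm)]
  simp only [PowerSeries.coeff_mk, h3, mul_sub, Finset.sum_sub_distrib]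
  ring

lemma HasExpansion.mul (hx₀ : x₀ ∈ puncturedPhaseSpace d) (hF : HasExpansion n x₀ F S)
    (hG : HasExpansion n x₀ G T) :
    HasExpansion n x₀ (fun p => F p * G p) (S * T) := by
  have h1 : (fun p : ℝ × PhaseSpace d =>
      (F p - ∑ k ∈ Finset.range n, p.1 ^ k * eval (obs p.2) (PowerSeries.coeff k S)) * G p)
      =O[𝓝 (0, x₀)] fun p => p.1 ^ n := by
    have h := IsBigO.mul hF (hG.isBigO_one hx₀)
    simp only [mul_one] at h
    exact h
  have h2 : HasExpansion n x₀ (fun p => F p * G p) (PowerSeries.mk fun k =>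
      ∑ q ∈ Finset.HasAntidiagonal.antidiagonal k,
        PowerSeries.coeff q.2 (PowerSeries.C (PowerSeries.coeff q.1 S) * T)) := by
    refine HasExpansion.double hx₀ (f := fun m p => eval (obs p.2) (PowerSeries.coeff m S) * G p)
      (Q := fun m => PowerSeries.C (PowerSeries.coeff m S) * T) ?_ fun m => ?_
    · refine h1.congr_left fun p => ?_
      simp only [sub_mul, Finset.sum_mul, mul_assoc]
    · have h3 := (isBigO_eval_obs hx₀ (PowerSeries.coeff m S)).mul hG
      simp only [one_mul] at h3
      refine h3.congr_left fun p => ?_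
      simp only [mul_sub, Finset.mul_sum, PowerSeries.coeff_C_mul, map_mul]
      congr 1
      exact Finset.sum_congr rfl fun k _ => by ring
  convert h2 using 1
  ext k : 1
  rw [PowerSeries.coeff_mk, PowerSeries.coeff_mul]
  simp only [PowerSeries.coeff_C_mul]

/-! ### Expansions of Lie transforms -/

/-- The Hamiltonian flow of `(p · q) Λ` on phase space. -/
noncomputable def genFlow (Λ : PNPoly) : ℝ × PhaseSpace d → PhaseSpace d :=
  flowMap (generatorField Λ) (puncturedPhaseSpace d)

lemma exists_nhds_genFlow (Λ : PNPoly) (hx₀ : x₀ ∈ puncturedPhaseSpace d) :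
    ∃ δ > 0, ∃ U, IsOpen U ∧ x₀ ∈ U ∧ U ⊆ puncturedPhaseSpace d ∧ ∀ s ∈ Ioo (-δ) δ, ∀ x ∈ U,
      FlowsTo (generatorField Λ) (puncturedPhaseSpace d) s x (genFlow Λ (s, x)) ∧
        ContDiffAt ℝ ∞ (genFlow Λ) (s, x) :=
  exists_nhds_flowMap isOpen_puncturedPhaseSpace (contDiffOn_generatorField Λ) hx₀

lemma genFlow_zero (Λ : PNPoly) {x : PhaseSpace d} (hx : x ∈ puncturedPhaseSpace d) :
    genFlow Λ (0, x) = x :=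
  flowMap_zero isOpen_puncturedPhaseSpace (contDiffOn_generatorField Λ) hx

lemma tendsto_genFlow (Λ : PNPoly) (hx₀ : x₀ ∈ puncturedPhaseSpace d) :
    Tendsto (genFlow Λ) (𝓝 (0, x₀)) (𝓝 x₀) := by
  obtain ⟨δ, hδ, U, -, hxU, -, h⟩ := exists_nhds_genFlow Λ hx₀
  have := (h 0 ⟨by linarith, hδ⟩ x₀ hxU).2.continuousAt.tendsto
  rwa [genFlow_zero Λ hx₀] at this

lemma hasDerivAt_eval_genFlow (Λ : PNPoly) (hx₀ : x₀ ∈ puncturedPhaseSpace d) (P : PNPoly) :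
    ∀ᶠ p in 𝓝 ((0 : ℝ), x₀), HasDerivAt (fun s => eval (obs (genFlow Λ (s, p.2))) P)
      (eval (obs (genFlow Λ p)) (bracket Λ P)) p.1 := by
  obtain ⟨δ, hδ, U, hU, hxU, hUM, h⟩ := exists_nhds_genFlow Λ hx₀
  have hmem : Ioo (-δ) δ ×ˢ U ∈ 𝓝 ((0 : ℝ), x₀) :=
    prod_mem_nhds (Ioo_mem_nhds (by linarith) hδ) (hU.mem_nhds hxU)
  filter_upwards [hmem] with p hp
  have hy : genFlow Λ p ∈ puncturedPhaseSpace d := (h p.1 hp.1 p.2 hp.2).1.mem_right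
  have hd := hasDerivAt_flowMap isOpen_puncturedPhaseSpace (contDiffOn_generatorField Λ) h hp.1 hp.2
  rw [← fderiv_eval_obs_generatorField Λ P hy]
  exact (hasFDerivAt_mvPolynomial_eval
    (hasFDerivAt_obs hy) P).differentiableAt.hasFDerivAt.comp_hasDerivAt p.1 hd

/-- Taylor expansion of the pullback of a polynomial observable by the flow. -/
lemma taylor_eval_genFlow (Λ : PNPoly) (hx₀ : x₀ ∈ puncturedPhaseSpace d) (m : ℕ) (P : PNPoly) :
    (fun p : ℝ × PhaseSpace d => eval (obs (genFlow Λ p)) P - ∑ j ∈ Finset.range m,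
      p.1 ^ j * eval (obs p.2) (((j.factorial : ℝ)⁻¹) • (bracket Λ)^[j] P))
      =O[𝓝 (0, x₀)] fun p => p.1 ^ m := by
  induction m generalizing P with
  | zero =>
    simp only [Finset.range_zero, Finset.sum_empty, sub_zero, pow_zero]
    exact ((contDiffAt_mvPolynomial_eval (contDiffAt_obs hx₀) P).continuousAt.tendsto.comp
      (tendsto_genFlow Λ hx₀)).isBigO_one ℝ
  | succ m ih =>
    refine isBigO_pow_succ_of_hasDerivAt (F' := fun p => eval (obs (genFlow Λ p)) (bracket Λ P) -
      ∑ j ∈ Finset.range m,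
        p.1 ^ j * eval (obs p.2) (((j.factorial : ℝ)⁻¹) • (bracket Λ)^[j] (bracket Λ P))) ?_ ?_
      (ih _)
    · filter_upwards [hasDerivAt_eval_genFlow Λ hx₀ P] with p hp
      refine hp.sub ?_
      have h1 : ∀ j, HasDerivAt
          (fun s : ℝ => s ^ j * eval (obs p.2) (((j.factorial : ℝ)⁻¹) • (bracket Λ)^[j] P))
          (j * p.1 ^ (j - 1) * eval (obs p.2) (((j.factorial : ℝ)⁻¹) • (bracket Λ)^[j] P)) p.1 :=
        fun j => (hasDerivAt_pow j p.1).mul_const _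
      refine (HasDerivAt.fun_sum fun j _ => h1 j).congr_deriv ?_
      rw [Finset.sum_range_succ']
      simp only [Nat.cast_zero, zero_mul, add_zero]
      refine Finset.sum_congr rfl fun j _ => ?_
      rw [Nat.add_sub_cancel, Function.iterate_succ_apply, smul_eval, smul_eval, Nat.factorial_succ]
      have : (j.factorial : ℝ) ≠ 0 := by positivity
      push_cast
      field_simp
    · filter_upwards [isOpen_puncturedPhaseSpace.mem_nhds hx₀] with x hx
      rw [genFlow_zero Λ hx, Finset.sum_range_succ']
      simp

/-- The formal pullback `exp (ε^i D) P` of a polynomial observable `P`, as a power series in `ε`,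
where `D = bracket Λ`. -/
noncomputable def lieExp (i : ℕ) (Λ P : PNPoly) : PowerSeries PNPoly :=
  PowerSeries.mk fun l =>
    if i ∣ l then (((l / i).factorial : ℝ)⁻¹) • (bracket Λ)^[l / i] P else 0

/-- The formal pullback `exp (ε^i D) S` of a power series `S` of polynomial observables, where
`D = bracket Λ`. -/
noncomputable def lieSeries (i : ℕ) (Λ : PNPoly) (S : PowerSeries PNPoly) : PowerSeries PNPoly :=
  PowerSeries.mk fun k => ∑ q ∈ Finset.HasAntidiagonal.antidiagonal k,
    PowerSeries.coeff q.2 (lieExp i Λ (PowerSeries.coeff q.1 S))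

lemma tendsto_pow_genFlow {i : ℕ} (hi : i ≠ 0) (x₀ : PhaseSpace d) :
    Tendsto (fun p : ℝ × PhaseSpace d => (p.1 ^ i, p.2)) (𝓝 (0, x₀)) (𝓝 (0, x₀)) := by
  have h : Continuous fun p : ℝ × PhaseSpace d => (p.1 ^ i, p.2) := by fun_prop
  simpa [hi] using h.tendsto ((0 : ℝ), x₀)

lemma hasExpansion_genFlow (Λ : PNPoly) (hx₀ : x₀ ∈ puncturedPhaseSpace d) {i : ℕ} (hi : i ≠ 0)
    (P : PNPoly) :
    HasExpansion n x₀ (fun p => eval (obs (genFlow Λ (p.1 ^ i, p.2))) P) (lieExp i Λ P) := by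
  have h1 := (taylor_eval_genFlow Λ hx₀ n P).comp_tendsto (tendsto_pow_genFlow hi x₀)
  simp only [Function.comp_def, ← pow_mul] at h1
  have hle : ∀ j, j ≤ i * j := fun j => Nat.le_mul_of_pos_left j (Nat.pos_of_ne_zero hi)
  set t : ℕ → ℝ × PhaseSpace d → ℝ := fun j p =>
    p.1 ^ (i * j) * eval (obs p.2) (((j.factorial : ℝ)⁻¹) • (bracket Λ)^[j] P) with ht
  -- the powers of `ε^i` in the Taylor expansion of order `n` that exceed `ε^n` are negligible
  have h2 : (fun p => ∑ j ∈ (Finset.range n).filter (fun j => ¬ i * j < n), t j p)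
      =O[𝓝 (0, x₀)] fun p => p.1 ^ n := by
    refine IsBigO.fun_sum fun j hj => ?_
    simpa using (isBigO_pow_of_le (not_lt.1 (Finset.mem_filter.1 hj).2)).mul
      (isBigO_eval_obs hx₀ _)
  refine ((h1.trans (isBigO_pow_of_le (hle n))).add h2).congr_left fun p => ?_
  have h3 : ∑ k ∈ Finset.range n, p.1 ^ k * eval (obs p.2) (PowerSeries.coeff k (lieExp i Λ P)) =
      ∑ j ∈ (Finset.range n).filter (fun j => i * j < n), t j p := by
    have h4 : ∀ k ∈ Finset.range n,
        p.1 ^ k * eval (obs p.2) (PowerSeries.coeff k (lieExp i Λ P)) =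
          if i ∣ k then t (k / i) p else 0 := by
      intro k _
      rw [lieExp, PowerSeries.coeff_mk]
      split_ifs with hk
      · simp only [ht, Nat.mul_div_cancel' hk]
      · simp
    rw [Finset.sum_congr rfl h4, ← Finset.sum_filter]
    refine Finset.sum_nbij' (fun k => k / i) (fun j => i * j) ?_ ?_ ?_ ?_ ?_
    · intro k hk
      simp only [Finset.mem_filter, Finset.mem_range] at hk ⊢
      rw [Nat.mul_div_cancel' hk.2]
      exact ⟨(Nat.div_le_self k i).trans_lt hk.1, hk.1⟩
    · intro j hj
      simp only [Finset.mem_filter, Finset.mem_range] at hj ⊢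
      exact ⟨hj.2, dvd_mul_right i j⟩
    · intro k hk
      exact Nat.mul_div_cancel' (Finset.mem_filter.1 hk).2
    · intro j _
      exact Nat.mul_div_cancel_left j (Nat.pos_of_ne_zero hi)
    · intro k _
      rfl
  rw [h3, ← Finset.sum_filter_add_sum_filter_not (Finset.range n) (fun j => i * j < n)]
  ring

/-- The expansion of the pullback by a Lie transform is the formal Lie series. -/
lemma HasExpansion.genFlow (Λ : PNPoly) (hx₀ : x₀ ∈ puncturedPhaseSpace d) {i : ℕ} (hi : i ≠ 0)
    (hF : HasExpansion n x₀ F S) :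
    HasExpansion n x₀ (fun p => F (p.1, genFlow Λ (p.1 ^ i, p.2))) (lieSeries i Λ S) := by
  have ht : Tendsto (fun p : ℝ × PhaseSpace d => (p.1, PNKepler.genFlow Λ (p.1 ^ i, p.2)))
      (𝓝 (0, x₀)) (𝓝 (0, x₀)) :=
    (continuous_fst.tendsto ((0 : ℝ), x₀)).prodMk_nhds
      ((tendsto_genFlow Λ hx₀).comp (tendsto_pow_genFlow hi x₀))
  exact HasExpansion.double hx₀
    (f := fun m p => eval (obs (PNKepler.genFlow Λ (p.1 ^ i, p.2))) (PowerSeries.coeff m S))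
    (Q := fun m => lieExp i Λ (PowerSeries.coeff m S))
    (IsBigO.comp_tendsto hF ht) fun m => hasExpansion_genFlow Λ hx₀ hi _

/-! ### The generators and the formal solution -/

/-- The monomial `b H_Kep^l (p_r²)^n / r^m`, with real coefficient `b`. -/
noncomputable def pnMonomial (b : ℝ) (l n m : ℕ) : PNPoly := C b * X 0 ^ l * X 1 ^ n * X 2 ^ m

lemma isHomogeneous_pnMonomial (r : ℝ) {l n m i : ℕ} (h : l + n + m = i) :
    (pnMonomial r l n m).IsHomogeneous i := by
  have h1 := (((isHomogeneous_C (Fin 3) r).mul (isHomogeneous_X_pow (R := ℝ) (0 : Fin 3) l)).mul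
    (isHomogeneous_X_pow (1 : Fin 3) n)).mul (isHomogeneous_X_pow (2 : Fin 3) m)
  rwa [zero_add, h] at h1

lemma eval_pnMonomial (v : Fin 3 → ℝ) (r : ℝ) (l n m : ℕ) :
    eval v (pnMonomial r l n m) = r * v 0 ^ l * v 1 ^ n * v 2 ^ m := by
  simp [pnMonomial]

lemma pderiv_zero_pnMonomial (r : ℝ) (l n m : ℕ) :
    pderiv 0 (pnMonomial r l n m) = pnMonomial (r * l) (l - 1) n m := by
  simp [pnMonomial, Derivation.leibniz, Derivation.leibniz_pow, pderiv_X]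
  ring

lemma pderiv_one_pnMonomial (r : ℝ) (l n m : ℕ) :
    pderiv 1 (pnMonomial r l n m) = pnMonomial (r * n) l (n - 1) m := by
  simp [pnMonomial, Derivation.leibniz, Derivation.leibniz_pow, pderiv_X]
  ring

lemma pderiv_two_pnMonomial (r : ℝ) (l n m : ℕ) :
    pderiv 2 (pnMonomial r l n m) = pnMonomial (r * m) l n (m - 1) := by
  simp [pnMonomial, Derivation.leibniz, Derivation.leibniz_pow, pderiv_X]
  ring

lemma eval_bracket (v : Fin 3 → ℝ) (Λ P : PNPoly) :
    eval v (bracket Λ P) =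
      eval v (pderiv 0 P) * (-(2 * v 0 + v 2) * eval v Λ + v 1 * (v 2 * eval v (pderiv 2 Λ) -
        2 * (2 * v 0 + v 2 - v 1) * eval v (pderiv 1 Λ))) +
      eval v (pderiv 1 P) * (2 * v 1 * (-eval v Λ + (2 * v 0 + v 2 - v 1) * eval v (pderiv 0 Λ) +
        v 2 * eval v (pderiv 2 Λ))) +
      eval v (pderiv 2 P) * (-v 2 * (eval v Λ + v 1 * eval v (pderiv 0 Λ) +
        2 * v 1 * eval v (pderiv 1 Λ))) := by
  rw [bracket_apply, Fin.sum_univ_three]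
  simp [bracket]

/-- The polynomials `Λ_i` of the five generators `ε^i (p · q) Λ_i`, where `g k` are the Taylor
coefficients of the coupling `γ = g ∘ τ`. The polynomial `Λ_i` is found from the linear equation
`{H_Kep, (p · q) Λ_i} = E_i - R_i`, in which `E_i` is `energyCoeff g i` and `R_i` is the coefficient
of `ε^i` in the pullback of `H_Kep` by the first `i - 1` Lie transforms. -/
noncomputable def lieCoeff (g : ℕ → ℝ) : ℕ → PNPoly
  | 1 =>
    pnMonomial (g 1) 1 0 0
  | 2 =>
    pnMonomial (-3 / 2 * g 1 ^ 2 + g 2) 2 0 0 + pnMonomial (-1 / 2 * g 1 ^ 2) 1 0 1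
  | 3 =>
    pnMonomial (5 * g 1 ^ 3 - 5 * g 1 * g 2 + g 3) 3 0 0 +
    pnMonomial (10 / 3 * g 1 ^ 3 - 2 * g 1 * g 2) 2 0 1 + pnMonomial (1 / 3 * g 1 ^ 3) 1 0 2 +
    pnMonomial (1 / 6 * g 1 ^ 3) 1 1 1
  | 4 =>
    pnMonomial (-75 / 4 * g 1 ^ 4 + 25 * g 1 ^ 2 * g 2 - 7 * g 1 * g 3 - 5 / 2 * g 2 ^ 2 +
      g 4) 4 0 0 +
    pnMonomial (-75 / 4 * g 1 ^ 4 + 75 / 4 * g 1 ^ 2 * g 2 - 3 * g 1 * g 3 - g 2 ^ 2) 3 0 1 +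
    pnMonomial (-19 / 4 * g 1 ^ 4 + 11 / 4 * g 1 ^ 2 * g 2) 2 0 2 +
    pnMonomial (-1 / 4 * g 1 ^ 4) 1 0 3 +
    pnMonomial (-19 / 24 * g 1 ^ 4 + 1 / 2 * g 1 ^ 2 * g 2) 2 1 1 +
    pnMonomial (-1 / 12 * g 1 ^ 4) 1 1 2 + pnMonomial (-1 / 8 * g 1 ^ 4) 1 2 1
  | 5 =>
    pnMonomial (84 * g 1 ^ 5 - 140 * g 1 ^ 3 * g 2 + 42 * g 1 ^ 2 * g 3 + 35 * g 1 * g 2 ^ 2 -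
      9 * g 1 * g 4 - 7 * g 2 * g 3 + g 5) 5 0 0 +
    pnMonomial (112 * g 1 ^ 5 - 457 / 3 * g 1 ^ 3 * g 2 + 34 * g 1 ^ 2 * g 3 +
      27 * g 1 * g 2 ^ 2 - 4 * g 1 * g 4 - 3 * g 2 * g 3) 4 0 1 +
    pnMonomial (139 / 3 * g 1 ^ 5 - 46 * g 1 ^ 3 * g 2 + 6 * g 1 ^ 2 * g 3 +
      4 * g 1 * g 2 ^ 2) 3 0 2 +
    pnMonomial (98 / 15 * g 1 ^ 5 - 11 / 3 * g 1 ^ 3 * g 2) 2 0 3 +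
    pnMonomial (1 / 5 * g 1 ^ 5) 1 0 4 +
    pnMonomial (23 / 6 * g 1 ^ 5 - 11 / 2 * g 1 ^ 3 * g 2 + 2 * g 1 * g 2 ^ 2) 3 1 1 +
    pnMonomial (2 / 3 * g 1 ^ 5 - 1 / 2 * g 1 ^ 3 * g 2) 2 1 2 +
    pnMonomial (1 / 15 * g 1 ^ 5) 1 1 3 + pnMonomial (29 / 20 * g 1 ^ 5 - g 1 ^ 3 * g 2) 2 2 1 +
    pnMonomial (1 / 12 * g 1 ^ 5) 1 2 2 + pnMonomial (1 / 8 * g 1 ^ 5) 1 3 1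
  | _ => 0

/-- The coefficients `E_k` of the formal solution `y = ε ∑ ε^k E_k` of
`y γ(y)² = ε p² / 2 - γ(y) ε / r`, where `γ` has the Taylor coefficients `1, g 1, g 2, …`. -/
noncomputable def energyCoeff (g : ℕ → ℝ) : ℕ → PNPoly
  | 0 =>
    pnMonomial 1 1 0 0
  | 1 =>
    pnMonomial (-2 * g 1) 2 0 0 + pnMonomial (-g 1) 1 0 1
  | 2 =>
    pnMonomial (7 * g 1 ^ 2 - 2 * g 2) 3 0 0 + pnMonomial (6 * g 1 ^ 2 - g 2) 2 0 1 +
    pnMonomial (g 1 ^ 2) 1 0 2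
  | 3 =>
    pnMonomial (-30 * g 1 ^ 3 + 18 * g 1 * g 2 - 2 * g 3) 4 0 0 +
    pnMonomial (-36 * g 1 ^ 3 + 16 * g 1 * g 2 - g 3) 3 0 1 +
    pnMonomial (-12 * g 1 ^ 3 + 3 * g 1 * g 2) 2 0 2 + pnMonomial (-g 1 ^ 3) 1 0 3
  | 4 =>
    pnMonomial (143 * g 1 ^ 4 - 132 * g 1 ^ 2 * g 2 + 22 * g 1 * g 3 + 11 * g 2 ^ 2 -
      2 * g 4) 5 0 0 +
    pnMonomial (220 * g 1 ^ 4 - 165 * g 1 ^ 2 * g 2 + 20 * g 1 * g 3 + 10 * g 2 ^ 2 - g 4) 4 0 1 +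
    pnMonomial (110 * g 1 ^ 4 - 60 * g 1 ^ 2 * g 2 + 4 * g 1 * g 3 + 2 * g 2 ^ 2) 3 0 2 +
    pnMonomial (20 * g 1 ^ 4 - 6 * g 1 ^ 2 * g 2) 2 0 3 + pnMonomial (g 1 ^ 4) 1 0 4
  | 5 =>
    pnMonomial (-728 * g 1 ^ 5 + 910 * g 1 ^ 3 * g 2 - 182 * g 1 ^ 2 * g 3 -
      182 * g 1 * g 2 ^ 2 + 26 * g 1 * g 4 + 26 * g 2 * g 3 - 2 * g 5) 6 0 0 +
    pnMonomial (-1365 * g 1 ^ 5 + 1456 * g 1 ^ 3 * g 2 - 234 * g 1 ^ 2 * g 3 -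
      234 * g 1 * g 2 ^ 2 + 24 * g 1 * g 4 + 24 * g 2 * g 3 - g 5) 5 0 1 +
    pnMonomial (-910 * g 1 ^ 5 + 780 * g 1 ^ 3 * g 2 - 90 * g 1 ^ 2 * g 3 - 90 * g 1 * g 2 ^ 2 +
      5 * g 1 * g 4 + 5 * g 2 * g 3) 4 0 2 +
    pnMonomial (-260 * g 1 ^ 5 + 160 * g 1 ^ 3 * g 2 - 10 * g 1 ^ 2 * g 3 -
      10 * g 1 * g 2 ^ 2) 3 0 3 +
    pnMonomial (-30 * g 1 ^ 5 + 10 * g 1 ^ 3 * g 2) 2 0 4 + pnMonomial (-g 1 ^ 5) 1 0 5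
  | _ => 0

/-- The coefficients of the pullback `exp (ε D) H_Kep` by the first Lie transform, below order five,
where `D = bracket (lieCoeff g 1)`. -/
noncomputable def firstPullback (g : ℕ → ℝ) : ℕ → PNPoly
  | 0 =>
    pnMonomial 1 1 0 0
  | 1 =>
    pnMonomial (-2 * g 1) 2 0 0 + pnMonomial (-g 1) 1 0 1
  | 2 =>
    pnMonomial (4 * g 1 ^ 2) 3 0 0 + pnMonomial (7 / 2 * g 1 ^ 2) 2 0 1 +
    pnMonomial (1 / 2 * g 1 ^ 2) 1 0 2 + pnMonomial (1 / 2 * g 1 ^ 2) 1 1 1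
  | 3 =>
    pnMonomial (-8 * g 1 ^ 3) 4 0 0 + pnMonomial (-59 / 6 * g 1 ^ 3) 3 0 1 +
    pnMonomial (-3 * g 1 ^ 3) 2 0 2 + pnMonomial (-1 / 6 * g 1 ^ 3) 1 0 3 +
    pnMonomial (-4 / 3 * g 1 ^ 3) 2 1 1 + pnMonomial (-1 / 6 * g 1 ^ 3) 1 1 2 +
    pnMonomial (-1 / 2 * g 1 ^ 3) 1 2 1
  | 4 =>
    pnMonomial (16 * g 1 ^ 4) 5 0 0 + pnMonomial (605 / 24 * g 1 ^ 4) 4 0 1 +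
    pnMonomial (95 / 8 * g 1 ^ 4) 3 0 2 + pnMonomial (41 / 24 * g 1 ^ 4) 2 0 3 +
    pnMonomial (1 / 24 * g 1 ^ 4) 1 0 4 + pnMonomial (83 / 24 * g 1 ^ 4) 3 1 1 +
    pnMonomial (19 / 12 * g 1 ^ 4) 2 1 2 + pnMonomial (1 / 12 * g 1 ^ 4) 1 1 3 +
    pnMonomial (7 / 8 * g 1 ^ 4) 2 2 1 + pnMonomial (-5 / 24 * g 1 ^ 4) 1 2 2 +
    pnMonomial (5 / 8 * g 1 ^ 4) 1 3 1
  | _ => 0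

lemma isHomogeneous_lieCoeff (g : ℕ → ℝ) (i : ℕ) : (lieCoeff g i).IsHomogeneous i := by
  unfold lieCoeff
  split
  all_goals first
    | exact isHomogeneous_zero _ _ _
    | (repeat' apply IsHomogeneous.add) <;> exact isHomogeneous_pnMonomial _ rfl

lemma bracket_firstPullback_zero (g : ℕ → ℝ) :
    bracket (lieCoeff g 1) (firstPullback g 0) = firstPullback g 1 := by
  refine MvPolynomial.funext fun v => ?_
  simp only [eval_bracket, lieCoeff, firstPullback, map_add, pderiv_zero_pnMonomial,
    pderiv_one_pnMonomial, pderiv_two_pnMonomial, eval_pnMonomial]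
  norm_num
  ring

lemma bracket_firstPullback_one (g : ℕ → ℝ) :
    bracket (lieCoeff g 1) (firstPullback g 1) = (2 : ℝ) • firstPullback g 2 := by
  refine MvPolynomial.funext fun v => ?_
  simp only [eval_bracket, lieCoeff, firstPullback, map_add, pderiv_zero_pnMonomial,
    pderiv_one_pnMonomial, pderiv_two_pnMonomial, eval_pnMonomial, smul_eval]
  norm_num
  ring

lemma bracket_firstPullback_two (g : ℕ → ℝ) :
    bracket (lieCoeff g 1) (firstPullback g 2) = (3 : ℝ) • firstPullback g 3 := by
  refine MvPolynomial.funext fun v => ?_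
  simp only [eval_bracket, lieCoeff, firstPullback, map_add, pderiv_zero_pnMonomial,
    pderiv_one_pnMonomial, pderiv_two_pnMonomial, eval_pnMonomial, smul_eval]
  norm_num
  ring

lemma bracket_firstPullback_three (g : ℕ → ℝ) :
    bracket (lieCoeff g 1) (firstPullback g 3) = (4 : ℝ) • firstPullback g 4 := by
  refine MvPolynomial.funext fun v => ?_
  simp only [eval_bracket, lieCoeff, firstPullback, map_add, pderiv_zero_pnMonomial,
    pderiv_one_pnMonomial, pderiv_two_pnMonomial, eval_pnMonomial, smul_eval]
  norm_num
  ring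

lemma bracket_two_firstPullback_zero (g : ℕ → ℝ) :
    bracket (lieCoeff g 2) (firstPullback g 0) =
      pnMonomial (3 * g 1 ^ 2 - 2 * g 2) 3 0 0 + pnMonomial (5 / 2 * g 1 ^ 2 - g 2) 2 0 1 +
      pnMonomial (1 / 2 * g 1 ^ 2) 1 0 2 + pnMonomial (-1 / 2 * g 1 ^ 2) 1 1 1 := by
  refine MvPolynomial.funext fun v => ?_
  simp only [eval_bracket, lieCoeff, firstPullback, map_add, pderiv_zero_pnMonomial,
    pderiv_one_pnMonomial, pderiv_two_pnMonomial, eval_pnMonomial]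
  norm_num
  ring

lemma bracket_two_firstPullback_one (g : ℕ → ℝ) :
    bracket (lieCoeff g 2) (firstPullback g 1) =
      pnMonomial (-12 * g 1 ^ 3 + 8 * g 1 * g 2) 4 0 0 +
      pnMonomial (-29 / 2 * g 1 ^ 3 + 7 * g 1 * g 2) 3 0 1 +
      pnMonomial (-5 * g 1 ^ 3 + g 1 * g 2) 2 0 2 + pnMonomial (-1 / 2 * g 1 ^ 3) 1 0 3 +
      pnMonomial (-g 1 ^ 3 + 2 * g 1 * g 2) 2 1 1 := by
  refine MvPolynomial.funext fun v => ?_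
  simp only [eval_bracket, lieCoeff, firstPullback, map_add, pderiv_zero_pnMonomial,
    pderiv_one_pnMonomial, pderiv_two_pnMonomial, eval_pnMonomial]
  norm_num
  ring

lemma coeff_lieSeries (i : ℕ) (Λ : PNPoly) (S : PowerSeries PNPoly) (k : ℕ) :
    PowerSeries.coeff k (lieSeries i Λ S) = ∑ q ∈ Finset.HasAntidiagonal.antidiagonal k,
      if i ∣ q.2 then (((q.2 / i).factorial : ℝ)⁻¹) •
        (bracket Λ)^[q.2 / i] (PowerSeries.coeff q.1 S) else 0 := by
  simp [lieSeries, lieExp]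

/-- The formal pullback of `H_Kep` by the composition `Φ_1 ∘ ⋯ ∘ Φ_5` of the Lie transforms: the
pullback by `Φ_1` comes first. -/
noncomputable def pullbackSeries (Λ : ℕ → PNPoly) : PowerSeries PNPoly :=
  lieSeries 5 (Λ 5) (lieSeries 4 (Λ 4) (lieSeries 3 (Λ 3) (lieSeries 2 (Λ 2)
    (lieSeries 1 (Λ 1) (PowerSeries.C (X 0))))))

lemma coeff_lieSeries_one (Λ P : PNPoly) (k : ℕ) :
    PowerSeries.coeff k (lieSeries 1 Λ (PowerSeries.C P)) =
      ((k.factorial : ℝ)⁻¹) • (bracket Λ)^[k] P := by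
  rw [coeff_lieSeries, Finset.Nat.sum_antidiagonal_eq_sum_range_succ_mk,
    Finset.sum_eq_single 0 (fun j _ hj => by simp [PowerSeries.coeff_C, hj]) (by simp)]
  simp

lemma coeff_succ_lieSeries_one (Λ P : PNPoly) (k : ℕ) :
    PowerSeries.coeff (k + 1) (lieSeries 1 Λ (PowerSeries.C P)) =
      ((k + 1 : ℕ) : ℝ)⁻¹ • bracket Λ (PowerSeries.coeff k (lieSeries 1 Λ (PowerSeries.C P))) := by
  rw [coeff_lieSeries_one, coeff_lieSeries_one, Function.iterate_succ_apply', Derivation.map_smul,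
    smul_smul, Nat.factorial_succ, Nat.cast_mul, mul_inv]

lemma coeff_firstPullback (g : ℕ → ℝ) {k : ℕ} (hk : k < 5) :
    PowerSeries.coeff k (lieSeries 1 (lieCoeff g 1) (PowerSeries.C (X 0))) = firstPullback g k := by
  have h0 : PowerSeries.coeff 0 (lieSeries 1 (lieCoeff g 1) (PowerSeries.C (X 0))) =
      firstPullback g 0 := by
    rw [coeff_lieSeries_one]
    simp [firstPullback, pnMonomial]
  have h1 := coeff_succ_lieSeries_one (lieCoeff g 1) (X 0) 0
  have h2 := coeff_succ_lieSeries_one (lieCoeff g 1) (X 0) 1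
  have h3 := coeff_succ_lieSeries_one (lieCoeff g 1) (X 0) 2
  have h4 := coeff_succ_lieSeries_one (lieCoeff g 1) (X 0) 3
  simp only [Nat.reduceAdd] at h1 h2 h3 h4
  rw [h0, bracket_firstPullback_zero, Nat.cast_one, inv_one, one_smul] at h1
  rw [h1, bracket_firstPullback_one, smul_smul] at h2
  norm_num at h2
  rw [h2, bracket_firstPullback_two, smul_smul] at h3
  norm_num at h3
  rw [h3, bracket_firstPullback_three, smul_smul] at h4
  norm_num at h4
  interval_cases k <;> assumption

lemma energyCoeff_two (g : ℕ → ℝ) :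
    bracket (lieCoeff g 2) (firstPullback g 0) + firstPullback g 2 = energyCoeff g 2 := by
  refine MvPolynomial.funext fun v => ?_
  simp only [eval_bracket, lieCoeff, firstPullback, energyCoeff, map_add, pderiv_zero_pnMonomial,
    pderiv_one_pnMonomial, pderiv_two_pnMonomial, eval_pnMonomial]
  norm_num
  ring

lemma energyCoeff_three (g : ℕ → ℝ) :
    bracket (lieCoeff g 3) (firstPullback g 0) +
      (bracket (lieCoeff g 2) (firstPullback g 1) + firstPullback g 3) = energyCoeff g 3 := by
  refine MvPolynomial.funext fun v => ?_
  simp only [eval_bracket, lieCoeff, firstPullback, energyCoeff, map_add, pderiv_zero_pnMonomial,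
    pderiv_one_pnMonomial, pderiv_two_pnMonomial, eval_pnMonomial]
  norm_num
  ring

lemma energyCoeff_four (g : ℕ → ℝ) :
    bracket (lieCoeff g 4) (firstPullback g 0) +
      (bracket (lieCoeff g 3) (firstPullback g 1) +
        ((2 : ℝ)⁻¹ • bracket (lieCoeff g 2) (bracket (lieCoeff g 2) (firstPullback g 0)) +
          (bracket (lieCoeff g 2) (firstPullback g 2) + firstPullback g 4))) =
      energyCoeff g 4 := by
  refine MvPolynomial.funext fun v => ?_
  rw [bracket_two_firstPullback_zero]
  simp only [eval_bracket, lieCoeff, firstPullback, energyCoeff, map_add, pderiv_zero_pnMonomial,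
    pderiv_one_pnMonomial, pderiv_two_pnMonomial, eval_pnMonomial, smul_eval]
  norm_num
  ring

lemma energyCoeff_five (g : ℕ → ℝ) :
    bracket (lieCoeff g 5) (firstPullback g 0) +
      (bracket (lieCoeff g 4) (firstPullback g 1) +
        (bracket (lieCoeff g 3) (bracket (lieCoeff g 2) (firstPullback g 0)) +
            bracket (lieCoeff g 3) (firstPullback g 2) +
          ((2 : ℝ)⁻¹ • bracket (lieCoeff g 2) (bracket (lieCoeff g 2) (firstPullback g 1)) +
            (bracket (lieCoeff g 2) (firstPullback g 3) +
              (5 : ℝ)⁻¹ • bracket (lieCoeff g 1) (firstPullback g 4))))) =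
      energyCoeff g 5 := by
  refine MvPolynomial.funext fun v => ?_
  rw [bracket_two_firstPullback_zero, bracket_two_firstPullback_one]
  simp only [eval_bracket, lieCoeff, firstPullback, energyCoeff, map_add, pderiv_zero_pnMonomial,
    pderiv_one_pnMonomial, pderiv_two_pnMonomial, eval_pnMonomial, smul_eval]
  norm_num
  ring

/-- The five Lie transforms carry `H_Kep` to the formal solution, up to order `ε^5`. -/
lemma coeff_pullbackSeries (g : ℕ → ℝ) {k : ℕ} (hk : k < 6) :
    PowerSeries.coeff k (pullbackSeries (lieCoeff g)) = energyCoeff g k := by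
  have h0 := coeff_firstPullback g (k := 0) (by norm_num)
  have h1 := coeff_firstPullback g (k := 1) (by norm_num)
  have h2 := coeff_firstPullback g (k := 2) (by norm_num)
  have h3 := coeff_firstPullback g (k := 3) (by norm_num)
  have h4 := coeff_firstPullback g (k := 4) (by norm_num)
  have h5 : PowerSeries.coeff 5 (lieSeries 1 (lieCoeff g 1) (PowerSeries.C (X 0))) =
      (5 : ℝ)⁻¹ • bracket (lieCoeff g 1) (firstPullback g 4) := by
    rw [coeff_succ_lieSeries_one, h4]
    norm_num
  rw [PowerSeries.coeff_zero_eq_constantCoeff_apply] at h0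
  rw [pullbackSeries]
  generalize lieSeries 1 (lieCoeff g 1) (PowerSeries.C (X 0)) = S at *
  interval_cases k
  · simp [coeff_lieSeries, h0, firstPullback, energyCoeff]
  · simp [coeff_lieSeries, Finset.Nat.antidiagonal_succ, h1, firstPullback, energyCoeff]
  · simp [coeff_lieSeries, Finset.Nat.antidiagonal_succ, h0, h2, ← energyCoeff_two]
  · simp [coeff_lieSeries, Finset.Nat.antidiagonal_succ, h0, h1, h3, ← energyCoeff_three]
  · simp [coeff_lieSeries, Finset.Nat.antidiagonal_succ, h0, h1, h2, h4, ← energyCoeff_four]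
  · simp [coeff_lieSeries, Finset.Nat.antidiagonal_succ, h0, h1, h2, h3, h5, ← energyCoeff_five]

/-- The formal series of `γ(y)`, for `y = ε S` and `γ` with Taylor coefficients `g k`. Taylor
coefficients beyond the fifth are left out, as they contribute to powers of `ε` beyond the fifth
only. -/
noncomputable def couplingSeries (g : ℕ → ℝ) (S : PowerSeries PNPoly) : PowerSeries PNPoly :=
  ∑ j ∈ Finset.range 6, PowerSeries.C (C (g j)) * (PowerSeries.X * S) ^ j

/-- The formal series of `(y γ(y)² - ε p² / 2 + γ(y) ε / r) / ε` for `y = ε S`. Here `p² / 2` is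
`H_Kep + 1 / r`. -/
noncomputable def residualSeries (g : ℕ → ℝ) (S : PowerSeries PNPoly) : PowerSeries PNPoly :=
  S * couplingSeries g S ^ 2 + PowerSeries.C (X 2) * couplingSeries g S -
    PowerSeries.C (X 0 + X 2)

/-- The coefficients of the series of `γ(y)` for the formal solution `y` of `energyCoeff`. -/
noncomputable def couplingCoeff (g : ℕ → ℝ) : ℕ → PNPoly
  | 0 =>
    pnMonomial 1 0 0 0
  | 1 =>
    pnMonomial (g 1) 1 0 0
  | 2 =>
    pnMonomial (-2 * g 1 ^ 2 + g 2) 2 0 0 + pnMonomial (-g 1 ^ 2) 1 0 1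
  | 3 =>
    pnMonomial (7 * g 1 ^ 3 - 6 * g 1 * g 2 + g 3) 3 0 0 +
    pnMonomial (6 * g 1 ^ 3 - 3 * g 1 * g 2) 2 0 1 + pnMonomial (g 1 ^ 3) 1 0 2
  | 4 =>
    pnMonomial (-30 * g 1 ^ 4 + 36 * g 1 ^ 2 * g 2 - 8 * g 1 * g 3 - 4 * g 2 ^ 2 + g 4) 4 0 0 +
    pnMonomial (-36 * g 1 ^ 4 + 32 * g 1 ^ 2 * g 2 - 4 * g 1 * g 3 - 2 * g 2 ^ 2) 3 0 1 +
    pnMonomial (-12 * g 1 ^ 4 + 6 * g 1 ^ 2 * g 2) 2 0 2 + pnMonomial (-g 1 ^ 4) 1 0 3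
  | 5 =>
    pnMonomial (143 * g 1 ^ 5 - 220 * g 1 ^ 3 * g 2 + 55 * g 1 ^ 2 * g 3 + 55 * g 1 * g 2 ^ 2 -
      10 * g 1 * g 4 - 10 * g 2 * g 3 + g 5) 5 0 0 +
    pnMonomial (220 * g 1 ^ 5 - 275 * g 1 ^ 3 * g 2 + 50 * g 1 ^ 2 * g 3 + 50 * g 1 * g 2 ^ 2 -
      5 * g 1 * g 4 - 5 * g 2 * g 3) 4 0 1 +
    pnMonomial (110 * g 1 ^ 5 - 100 * g 1 ^ 3 * g 2 + 10 * g 1 ^ 2 * g 3 +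
      10 * g 1 * g 2 ^ 2) 3 0 2 +
    pnMonomial (20 * g 1 ^ 5 - 10 * g 1 ^ 3 * g 2) 2 0 3 + pnMonomial (g 1 ^ 5) 1 0 4
  | _ => 0

lemma coeff_couplingSeries (g : ℕ → ℝ) (hg : g 0 = 1) {S : PowerSeries PNPoly}
    (hS : ∀ k < 6, PowerSeries.coeff k S = energyCoeff g k) {k : ℕ} (hk : k < 6) :
    PowerSeries.coeff k (couplingSeries g S) = couplingCoeff g k := by
  simp only [couplingSeries, Finset.sum_range_succ, Finset.sum_range_zero, map_add, mul_pow,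
    PowerSeries.coeff_C_mul, PowerSeries.coeff_X_pow_mul']
  refine MvPolynomial.funext fun v => ?_
  interval_cases k <;>
  simp [PowerSeries.coeff_mul, Finset.Nat.antidiagonal_succ, pow_succ, hS, hg, energyCoeff,
    couplingCoeff, eval_pnMonomial] <;>
  ring

lemma coeff_residualSeries (g : ℕ → ℝ) (hg : g 0 = 1) {S : PowerSeries PNPoly}
    (hS : ∀ k < 6, PowerSeries.coeff k S = energyCoeff g k) {k : ℕ} (hk : k < 6) :
    PowerSeries.coeff k (residualSeries g S) = 0 := by
  have hT : ∀ k < 6, PowerSeries.coeff k (couplingSeries g S) = couplingCoeff g k :=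
    fun k hk => coeff_couplingSeries g hg hS hk
  have hS0 := hS 0 (by norm_num)
  have hT0 := hT 0 (by norm_num)
  rw [PowerSeries.coeff_zero_eq_constantCoeff_apply] at hS0 hT0
  rw [residualSeries]
  generalize couplingSeries g S = T at *
  refine MvPolynomial.funext fun v => ?_
  interval_cases k <;>
  simp [sq, PowerSeries.coeff_mul, PowerSeries.coeff_C, Finset.Nat.antidiagonal_succ, hS, hT, hS0,
    hT0, energyCoeff, couplingCoeff, eval_pnMonomial] <;>
  ring

/-- A homogeneous polynomial in `H_Kep = p² / 2 - 1 / r`, `p_r²` and `1 / r` becomes, after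
expansion of `H_Kep`, a linear combination of the monomials in `pnPolynomial`. -/
lemma exists_pnPolynomial_eq {i : ℕ} {Λ : PNPoly} (hΛ : Λ.IsHomogeneous i) :
    ∃ a : ℕ → ℕ → ℕ → ℝ, ∀ {d : ℕ} (x : PhaseSpace d), pnPolynomial i a x = eval (obs x) Λ := by
  -- substitution of `H_Kep`, `p_r²`, `1 / r` by polynomials in `p²`, `1 / r`, `p_r²`; the new
  -- variables are in the order of the indices of `a`
  let b : Fin 3 → PNPoly := ![C (1 / 2) * X 0 - X 1, X 2, X 1]
  have hb : ∀ j, (b j).IsHomogeneous 1 := by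
    intro j
    fin_cases j
    · have h := (isHomogeneous_C (Fin 3) (1 / 2 : ℝ)).mul (isHomogeneous_X ℝ (0 : Fin 3))
      rw [zero_add] at h
      exact h.sub (isHomogeneous_X ℝ (1 : Fin 3))
    · exact isHomogeneous_X ℝ (2 : Fin 3)
    · exact isHomogeneous_X ℝ (1 : Fin 3)
  set Q : PNPoly := aeval b Λ with hQ
  have hQh : Q.IsHomogeneous i := by
    have := hΛ.aeval b hb
    rwa [one_mul] at this
  refine ⟨fun l m n => coeff (Finsupp.equivFunOnFinite.symm ![l, m, n]) Q, fun {d} x => ?_⟩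
  let v : Fin 3 → ℝ := ![momentumSq x, 1 / radius x, radialMomentum x ^ 2]
  have hv : eval v Q = eval (obs x) Λ := by
    have h1 : eval v Q = eval (fun j => eval v (b j)) Λ := by
      rw [hQ]
      clear_value Q
      clear hQ hQh hΛ
      induction Λ using MvPolynomial.induction_on with
      | C r => simp
      | add P P' h h' => rw [map_add, map_add, map_add, h, h']
      | mul_X P j h => rw [map_mul, map_mul, map_mul, h, aeval_X, eval_X]
    rw [h1]
    congr 2
    ext j
    fin_cases j
    · simp [b, v, obs, keplerHamiltonian]
      ring
    · simp [b, v, obs]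
    · simp [b, v, obs]
  rw [← hv, eval_eq']
  have hsub : Q.support ⊆ (Finset.Nat.antidiagonalTuple 3 i).map
      Finsupp.equivFunOnFinite.symm.toEmbedding := by
    intro e he
    rw [Finset.mem_map_equiv, Finset.Nat.mem_antidiagonalTuple]
    have h2 := hQh (mem_support_iff.1 he)
    have h3 : e.degree = i := by rw [Finsupp.degree_eq_weight_one]; exact h2
    rw [← h3, Finsupp.degree_eq_sum]
    rfl
  rw [Finset.sum_subset hsub fun e _ he => by simp [notMem_support_iff.1 he], Finset.sum_map]
  refine Finset.sum_congr rfl fun k _ => ?_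
  have hk : ![k 0, k 1, k 2] = k := by ext j; fin_cases j <;> rfl
  beta_reduce
  rw [hk, Fin.prod_univ_three]
  simp [v]
  left
  ring

/-! ### Compositions of Lie transforms -/

/-- Near `(0, x₀)`, the flow of `(p · q) Λ` is defined, smooth and symplectic. -/
lemma eventually_genFlow (Λ : PNPoly) (hx₀ : x₀ ∈ puncturedPhaseSpace d) :
    ∀ᶠ p in 𝓝 ((0 : ℝ), x₀),
      FlowsTo (generatorField Λ) (puncturedPhaseSpace d) p.1 p.2 (genFlow Λ p) ∧
      ContDiffAt ℝ ∞ (genFlow Λ) p ∧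
      ∀ v w, symplecticForm (fderiv ℝ (fun y => genFlow Λ (p.1, y)) p.2 v)
        (fderiv ℝ (fun y => genFlow Λ (p.1, y)) p.2 w) = symplecticForm v w := by
  obtain ⟨δ, hδ, U, hU, hxU, hUM, h⟩ := exists_nhds_genFlow Λ hx₀
  have hmem : Ioo (-δ) δ ×ˢ U ∈ 𝓝 ((0 : ℝ), x₀) :=
    prod_mem_nhds (Ioo_mem_nhds (by linarith) hδ) (hU.mem_nhds hxU)
  filter_upwards [hmem] with p hp
  exact ⟨(h _ hp.1 _ hp.2).1, (h _ hp.1 _ hp.2).2,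
    bilin_fderiv_flowMap isOpen_puncturedPhaseSpace (contDiffOn_generatorField Λ) hU hUM h
      (symplecticCLM d) (fun x hx => symplecticCLM_fderiv_generatorField Λ hx) hp.1 hp.2⟩

/-- The point reached from `x`, where `p = (ε, x)`, after the first `j` of the Lie transforms
`Φ_N, Φ_(N-1), …, Φ_1`, in which `Φ_i` has the generator `ε^i (p · q) Λ_i`. It is the flow for time
`ε^i` of the generator `(p · q) Λ_i`. -/
noncomputable def lieChain (N : ℕ) (Λ : ℕ → PNPoly) (p : ℝ × PhaseSpace d) : ℕ → PhaseSpace d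
  | 0 => p.2
  | j + 1 => genFlow (Λ (N - j)) (p.1 ^ (N - j), lieChain N Λ p j)

lemma lieChain_zero_left (N : ℕ) (Λ : ℕ → PNPoly) {x : PhaseSpace d}
    (hx : x ∈ puncturedPhaseSpace d) {j : ℕ} (hj : j ≤ N) : lieChain N Λ (0, x) j = x := by
  induction j with
  | zero => rfl
  | succ j ih =>
    have h1 : N - j ≠ 0 := by omega
    simp only [lieChain, ih (by omega), zero_pow h1]
    exact genFlow_zero _ hx

/-- Near `(0, x₀)`, the partial compositions of the Lie transforms exist and are smooth and
symplectic. -/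
lemma eventually_lieChain (N : ℕ) (Λ : ℕ → PNPoly) (hx₀ : x₀ ∈ puncturedPhaseSpace d) {j : ℕ}
    (hj : j ≤ N) :
    (∀ᶠ p in 𝓝 ((0 : ℝ), x₀), ContDiffAt ℝ ∞ (fun p => lieChain N Λ p j) p ∧
      (∀ v w, symplecticForm (fderiv ℝ (fun y => lieChain N Λ (p.1, y) j) p.2 v)
        (fderiv ℝ (fun y => lieChain N Λ (p.1, y) j) p.2 w) = symplecticForm v w) ∧
      ∀ k < j, FlowsTo (generatorField (Λ (N - k))) (puncturedPhaseSpace d) (p.1 ^ (N - k))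
        (lieChain N Λ p k) (lieChain N Λ p (k + 1))) := by
  induction j with
  | zero =>
    refine Eventually.of_forall fun p => ⟨contDiffAt_snd, fun v w => ?_, by simp⟩
    have h : (fun y : PhaseSpace d => lieChain N Λ (p.1, y) 0) = id := rfl
    rw [h, fderiv_id]
    rfl
  | succ j ih =>
    have h1 : N - j ≠ 0 := by omega
    have ih := ih (by omega)
    have htend : Tendsto (fun p : ℝ × PhaseSpace d => (p.1 ^ (N - j), lieChain N Λ p j))
        (𝓝 (0, x₀)) (𝓝 (0, x₀)) := by
      have h2 : Tendsto (fun p : ℝ × PhaseSpace d => p.1 ^ (N - j)) (𝓝 (0, x₀)) (𝓝 0) := by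
        have h3 : Continuous fun p : ℝ × PhaseSpace d => p.1 ^ (N - j) := by fun_prop
        simpa [h1] using h3.tendsto ((0 : ℝ), x₀)
      have h4 := ih.self_of_nhds.1.continuousAt.tendsto
      rw [lieChain_zero_left N Λ hx₀ (by omega)] at h4
      exact h2.prodMk_nhds h4
    filter_upwards [ih, htend.eventually (eventually_genFlow (Λ (N - j)) hx₀)] with p hp hq
    refine ⟨?_, fun v w => ?_, fun k hk => ?_⟩
    · exact hq.2.1.comp p ((contDiffAt_fst.pow (N - j)).prodMk hp.1)
    · have hpair : ∀ s : ℝ, ∀ y : PhaseSpace d,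
          DifferentiableAt ℝ (fun y : PhaseSpace d => (s, y)) y := fun s y =>
        (differentiableAt_const s).prodMk differentiableAt_id
      have hd1 : DifferentiableAt ℝ (fun y => lieChain N Λ (p.1, y) j) p.2 :=
        DifferentiableAt.comp (g := fun p => lieChain N Λ p j) p.2
          (hp.1.differentiableAt (by simp)) (hpair p.1 p.2)
      have hd2 : DifferentiableAt ℝ (fun y => genFlow (Λ (N - j)) (p.1 ^ (N - j), y))
          (lieChain N Λ p j) :=
        DifferentiableAt.comp (g := genFlow (Λ (N - j))) _
          (hq.2.1.differentiableAt (by simp)) (hpair _ _)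
      have hcomp : fderiv ℝ (fun y => lieChain N Λ (p.1, y) (j + 1)) p.2 =
          (fderiv ℝ (fun y => genFlow (Λ (N - j)) (p.1 ^ (N - j), y)) (lieChain N Λ p j)).comp
            (fderiv ℝ (fun y => lieChain N Λ (p.1, y) j) p.2) :=
        fderiv_comp (g := fun y => genFlow (Λ (N - j)) (p.1 ^ (N - j), y)) p.2 hd2 hd1
      rw [hcomp]
      exact (hq.2.2 _ _).trans (hp.2.1 v w)
    · rcases Nat.lt_succ_iff_lt_or_eq.1 hk with hk | rfl
      · exact hp.2.2 k hk
      · exact hq.1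

/-- The partial compositions are injective, since flows can be reversed. -/
lemma lieChain_injective {N : ℕ} {Λ : ℕ → PNPoly} {s : ℝ} {x y : PhaseSpace d} {j : ℕ}
    (hx : ∀ k < j, FlowsTo (generatorField (Λ (N - k))) (puncturedPhaseSpace d) (s ^ (N - k))
        (lieChain N Λ (s, x) k) (lieChain N Λ (s, x) (k + 1)))
    (hy : ∀ k < j, FlowsTo (generatorField (Λ (N - k))) (puncturedPhaseSpace d) (s ^ (N - k))
        (lieChain N Λ (s, y) k) (lieChain N Λ (s, y) (k + 1)))
    (h : lieChain N Λ (s, x) j = lieChain N Λ (s, y) j) : x = y := by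
  induction j with
  | zero => exact h
  | succ j ih =>
    refine ih (fun k hk => hx k (by omega)) (fun k hk => hy k (by omega)) ?_
    have h1 := hx j (by omega)
    rw [h] at h1
    exact h1.unique_left isOpen_puncturedPhaseSpace (contDiffOn_generatorField _) (hy j (by omega))

/-! ### The order of the residual -/

lemma hasExpansion_lieChain (Λ : ℕ → PNPoly) (hx₀ : x₀ ∈ puncturedPhaseSpace d) :
    HasExpansion n x₀ (fun p => keplerHamiltonian (lieChain 5 Λ p 5)) (pullbackSeries Λ) := by
  have h := (((((hasExpansion_eval n hx₀ (X 0)).genFlow (Λ 1) hx₀ one_ne_zero).genFlow (Λ 2) hx₀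
    two_ne_zero).genFlow (Λ 3) hx₀ three_ne_zero).genFlow (Λ 4) hx₀ four_ne_zero).genFlow (Λ 5) hx₀
    (by norm_num : 5 ≠ 0)
  simp only [eval_X] at h
  exact h

lemma hasExpansion_fst (hx₀ : x₀ ∈ puncturedPhaseSpace d) :
    HasExpansion n x₀ (fun p => p.1) PowerSeries.X := by
  refine HasExpansion.mono hx₀ (Nat.le_add_right n 2) ?_
  refine (isBigO_zero _ _).congr_left fun p => ?_
  rw [Finset.sum_eq_single 1 (fun k _ hk => by simp [PowerSeries.coeff_X, hk]) (by simp)]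
  simp

lemma HasExpansion.pow (hx₀ : x₀ ∈ puncturedPhaseSpace d) (hF : HasExpansion n x₀ F S) (j : ℕ) :
    HasExpansion n x₀ (fun p => F p ^ j) (S ^ j) := by
  induction j with
  | zero => simpa using hasExpansion_eval n hx₀ (1 : PNPoly)
  | succ j ih => simpa only [pow_succ] using ih.mul hx₀ hF

lemma HasExpansion.const_mul (hx₀ : x₀ ∈ puncturedPhaseSpace d) (hF : HasExpansion n x₀ F S)
    (c : ℝ) : HasExpansion n x₀ (fun p => c * F p) (PowerSeries.C (C c) * S) := by
  simpa using (hasExpansion_eval n hx₀ (C c)).mul hx₀ hF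

lemma hasExpansion_coupling (hx₀ : x₀ ∈ puncturedPhaseSpace d) (hF : HasExpansion n x₀ F S)
    (g : ℕ → ℝ) : HasExpansion n x₀
      (fun p => ∑ j ∈ Finset.range 6, g j * (p.1 * F p) ^ j) (couplingSeries g S) := by
  have h := fun j => ((((hasExpansion_fst hx₀).mul hx₀ hF).pow hx₀ j).const_mul hx₀ (g j))
  simp only [couplingSeries, Finset.sum_range_succ, Finset.sum_range_zero, zero_add]
  exact (((((h 0).add (h 1)).add (h 2)).add (h 3)).add (h 4)).add (h 5)

/-- If the Lie transforms are built from the Taylor coefficients of `γ = g ∘ τ`, then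
`y = ε H_Kep ∘ Φ` satisfies `y γ(y)² = ε p² / 2 - γ(y) ε / r` up to an error of order `ε^7`. -/
lemma isBigO_residual (hx₀ : x₀ ∈ puncturedPhaseSpace d) {γ : ℝ → ℝ} (hγ : ContDiff ℝ ∞ γ)
    (hγ0 : γ 0 = 1) {c : ℕ → ℝ} (hc : ∀ k, c k = iteratedDeriv k γ 0 / k.factorial) :
    (fun p : ℝ × PhaseSpace d =>
      let y := p.1 * keplerHamiltonian (lieChain 5 (lieCoeff c) p 5)
      y * γ y ^ 2 - (p.1 * (momentumSq p.2 / 2) - γ y * (p.1 / radius p.2)))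
      =O[𝓝 (0, x₀)] fun p => p.1 ^ 7 := by
  set η : ℝ × PhaseSpace d → ℝ := fun p => keplerHamiltonian (lieChain 5 (lieCoeff c) p 5) with hη
  have hηe : HasExpansion 6 x₀ η (pullbackSeries (lieCoeff c)) :=
    hasExpansion_lieChain (lieCoeff c) hx₀
  have hc0 : c 0 = 1 := by simp [hc, hγ0]
  have hfst : Tendsto (fun p : ℝ × PhaseSpace d => p.1) (𝓝 (0, x₀)) (𝓝 0) :=
    continuous_fst.tendsto ((0 : ℝ), x₀)
  have hyO : (fun p => p.1 * η p) =O[𝓝 (0, x₀)] fun p => p.1 := by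
    simpa using (isBigO_refl (fun p : ℝ × PhaseSpace d => p.1) _).mul (hηe.isBigO_one hx₀)
  have hy0 : Tendsto (fun p => p.1 * η p) (𝓝 (0, x₀)) (𝓝 0) := hyO.trans_tendsto hfst
  have hγe : HasExpansion 6 x₀ (fun p => γ (p.1 * η p))
      (couplingSeries c (pullbackSeries (lieCoeff c))) := by
    have h1 := ((isBigO_sub_taylor hγ 6).comp_tendsto hy0).trans (hyO.pow 6)
    refine (h1.add (hasExpansion_coupling hx₀ hηe c)).congr_left fun p => ?_
    simp only [Function.comp_apply, ← hc]
    ring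
  have hres : HasExpansion 6 x₀ (fun p => η p * γ (p.1 * η p) ^ 2 +
      eval (obs p.2) (X 2) * γ (p.1 * η p) + (-1) * eval (obs p.2) (X 0 + X 2))
      (residualSeries c (pullbackSeries (lieCoeff c))) := by
    have h1 := ((hηe.mul hx₀ (hγe.pow hx₀ 2)).add
      ((hasExpansion_eval 6 hx₀ (X 2)).mul hx₀ hγe)).add
      ((hasExpansion_eval 6 hx₀ (X 0 + X 2)).const_mul hx₀ (-1))
    convert h1 using 1
    simp [residualSeries, sub_eq_add_neg]
  have hO : (fun p => η p * γ (p.1 * η p) ^ 2 + eval (obs p.2) (X 2) * γ (p.1 * η p) +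
      (-1) * eval (obs p.2) (X 0 + X 2)) =O[𝓝 (0, x₀)] fun p => p.1 ^ 6 := by
    refine IsBigO.congr_left hres fun p => ?_
    rw [Finset.sum_eq_zero fun k hk => by
      rw [coeff_residualSeries c hc0 (fun k hk => coeff_pullbackSeries c hk)
        (Finset.mem_range.1 hk), map_zero, mul_zero], sub_zero]
  refine ((isBigO_refl (fun p : ℝ × PhaseSpace d => p.1) _).mul hO).congr (fun p => ?_)
    fun p => (pow_succ' p.1 6).symm
  have e0 : obs p.2 0 = momentumSq p.2 / 2 - 1 / radius p.2 := rfl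
  have e2 : obs p.2 2 = 1 / radius p.2 := rfl
  simp only [map_add, eval_X, e0, e2]
  ring

/-- The local statements near the points of a compact set combine into the canonical
transformation on a neighbourhood of the set. -/
theorem exists_lieTransform_solution {f g τ : ℝ → ℝ} (hg : ContDiff ℝ ∞ g) (hτ : ContDiff ℝ ∞ τ)
    (hg0 : g 0 = 1) (hτ0 : τ 0 = 0) (hτf : ∀ᶠ y in 𝓝 0, f (τ y) = y * g (τ y) ^ 2)
    {c : ℕ → ℝ} (hc : ∀ k, c k = iteratedDeriv k (fun y => g (τ y)) 0 / k.factorial)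
    {a : ℕ → ℕ → ℕ → ℕ → ℝ}
    (ha : ∀ i (x : PhaseSpace d), pnPolynomial i (a i) x = eval (obs x) (lieCoeff c i))
    {K : Set (PhaseSpace d)} (hK : IsCompact K) (hKM : K ⊆ puncturedPhaseSpace d) :
    ∃ (U : Set (PhaseSpace d)) (ε₀ C : ℝ) (Φ : ℝ → PhaseSpace d → PhaseSpace d),
      IsOpen U ∧ K ⊆ U ∧ U ⊆ puncturedPhaseSpace d ∧ 0 < ε₀ ∧
      IsNearIdentityCanonicalOn Φ ε₀ U ∧
      (∀ ε ∈ Ioo (-ε₀) ε₀, IsLieTransformComposition 5 a ε (Φ ε) U) ∧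
      ∀ ε ∈ Ioo (-ε₀) ε₀, ∀ x ∈ U,
        |f (τ (ε * keplerHamiltonian (Φ ε x))) - (ε * (momentumSq x / 2) -
          g (τ (ε * keplerHamiltonian (Φ ε x))) * (ε / radius x))| ≤ C * |ε| ^ 7 := by
  let Φ : ℝ → PhaseSpace d → PhaseSpace d := fun ε x => lieChain 5 (lieCoeff c) (ε, x) 5
  let P : ℝ → ℝ × PhaseSpace d → Prop := fun C p =>
    (ContDiffAt ℝ ∞ (fun p => lieChain 5 (lieCoeff c) p 5) p ∧
      (∀ v w, symplecticForm (fderiv ℝ (fun y => lieChain 5 (lieCoeff c) (p.1, y) 5) p.2 v)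
        (fderiv ℝ (fun y => lieChain 5 (lieCoeff c) (p.1, y) 5) p.2 w) = symplecticForm v w) ∧
      ∀ k < 5, FlowsTo (generatorField (lieCoeff c (5 - k))) (puncturedPhaseSpace d)
        (p.1 ^ (5 - k)) (lieChain 5 (lieCoeff c) p k) (lieChain 5 (lieCoeff c) p (k + 1))) ∧
    |f (τ (p.1 * keplerHamiltonian (Φ p.1 p.2))) - (p.1 * (momentumSq p.2 / 2) -
      g (τ (p.1 * keplerHamiltonian (Φ p.1 p.2))) * (p.1 / radius p.2))| ≤ C * |p.1| ^ 7
  have hloc : ∀ x₀ ∈ puncturedPhaseSpace d, ∃ C, ∀ᶠ p in 𝓝 ((0 : ℝ), x₀), P C p := by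
    intro x₀ hx₀
    obtain ⟨C, hC⟩ := (isBigO_residual hx₀ (hg.comp hτ) (by simp [hτ0, hg0]) hc).bound
    have hy0 : Tendsto (fun p : ℝ × PhaseSpace d => p.1 * keplerHamiltonian (Φ p.1 p.2))
        (𝓝 (0, x₀)) (𝓝 0) := by
      have h1 := (hasExpansion_lieChain (n := 0) (lieCoeff c) hx₀).isBigO_one hx₀
      have h2 := (isBigO_refl (fun p : ℝ × PhaseSpace d => p.1) (𝓝 (0, x₀))).mul h1
      simp only [mul_one] at h2
      exact h2.trans_tendsto (continuous_fst.tendsto ((0 : ℝ), x₀))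
    refine ⟨C, ?_⟩
    filter_upwards [eventually_lieChain 5 (lieCoeff c) hx₀ le_rfl, hC, hy0.eventually hτf]
      with p h1 h2 h3
    refine ⟨h1, ?_⟩
    rw [h3]
    simpa [Φ] using h2
  obtain ⟨U, ε₀, C, hUo, hKU, hUM, hε₀, hP⟩ : ∃ (U : Set (PhaseSpace d)) (ε₀ C : ℝ), IsOpen U ∧
      K ⊆ U ∧ U ⊆ puncturedPhaseSpace d ∧ 0 < ε₀ ∧ ∀ ε ∈ Ioo (-ε₀) ε₀, ∀ x ∈ U, P C (ε, x) := by
    refine hK.induction_on (p := fun s => ∃ (U : Set (PhaseSpace d)) (ε₀ C : ℝ), IsOpen U ∧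
      s ⊆ U ∧ U ⊆ puncturedPhaseSpace d ∧ 0 < ε₀ ∧ ∀ ε ∈ Ioo (-ε₀) ε₀, ∀ x ∈ U, P C (ε, x))
      ?_ ?_ ?_ ?_
    · exact ⟨∅, 1, 0, isOpen_empty, empty_subset _, empty_subset _, one_pos, by simp⟩
    · rintro s t hst ⟨U, ε₀, C, h1, h2, h3⟩
      exact ⟨U, ε₀, C, h1, hst.trans h2, h3⟩
    · rintro s t ⟨U, ε, C, h1, h2, h3, h4, h5⟩ ⟨U', ε', C', h1', h2', h3', h4', h5'⟩
      have hmono : ∀ {C C' : ℝ} {p : ℝ × PhaseSpace d}, C ≤ C' → P C p → P C' p :=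
        fun hCC hp => ⟨hp.1, hp.2.trans (mul_le_mul_of_nonneg_right hCC (by positivity))⟩
      refine ⟨U ∪ U', min ε ε', max C C', h1.union h1', union_subset_union h2 h2',
        union_subset h3 h3', lt_min h4 h4', fun e he x hx => ?_⟩
      rcases hx with hx | hx
      · exact hmono (le_max_left _ _) (h5 e ⟨(neg_le_neg (min_le_left _ _)).trans_lt he.1,
          he.2.trans_le (min_le_left _ _)⟩ x hx)
      · exact hmono (le_max_right _ _) (h5' e ⟨(neg_le_neg (min_le_right _ _)).trans_lt he.1,
          he.2.trans_le (min_le_right _ _)⟩ x hx)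
    · intro x hx
      obtain ⟨C, hC⟩ := hloc x (hKM hx)
      rw [nhds_prod_eq, Filter.eventually_prod_iff] at hC
      obtain ⟨pa, ha', pb, hb, hab⟩ := hC
      obtain ⟨δ, hδ, hball⟩ := Metric.eventually_nhds_iff_ball.1 ha'
      obtain ⟨U, hU, hUo, hxU⟩ := eventually_nhds_iff.1
        (hb.and (isOpen_puncturedPhaseSpace.mem_nhds (hKM hx)))
      refine ⟨U, mem_nhdsWithin_of_mem_nhds (hUo.mem_nhds hxU), U, δ, C, hUo, subset_rfl,
        fun y hy => (hU y hy).2, hδ, fun ε hε y hy => hab (hball ε ?_) (hU y hy).1⟩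
      rwa [Real.ball_eq_Ioo, zero_sub, zero_add]
  refine ⟨U, ε₀, C, Φ, hUo, hKU, hUM, hε₀, ⟨fun ε hε => ⟨fun x hx => ?_, fun x hx y hy hxy => ?_,
    fun x hx => ?_, fun x hx => ?_⟩, fun p hp => ?_, fun x hx => ?_⟩, fun ε hε x hx => ?_,
    fun ε hε x hx => (hP ε hε x hx).2⟩
  · exact ((hP ε hε x hx).1.2.2 4 (by norm_num)).mem_right
  · exact lieChain_injective (hP ε hε x hx).1.2.2 (hP ε hε y hy).1.2.2 hxy
  · exact ((hP ε hε x hx).1.1.comp x (contDiffAt_const.prodMk contDiffAt_id)).contDiffWithinAt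
  · exact (hP ε hε x hx).1.2.1
  · exact (hP p.1 hp.1 p.2 hp.2).1.1.contDiffWithinAt
  · exact lieChain_zero_left 5 (lieCoeff c) (hUM hx) le_rfl
  · refine ⟨fun i => lieChain 5 (lieCoeff c) (ε, x) (5 - i), rfl, rfl, fun i hi => ?_⟩
    obtain ⟨hi1, hi5⟩ := Finset.mem_Icc.1 hi
    have h1 := (hP ε hε x hx).1.2.2 (5 - i) (by omega)
    have e1 : 5 - (5 - i) = i := by omega
    have e2 : 5 - (i - 1) = 5 - i + 1 := by omega
    simp only [e1] at h1
    beta_reduce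
    rw [e2]
    refine timeOneFlow_of_flowsTo (fun y _ => ?_) h1
    rw [lieGenerator, ha i y, generator]

end PNKepler

theorem mainTheorem4 (d : ℕ) (f g : ℝ → ℝ) (hf : ContDiff ℝ ∞ f) (hg : ContDiff ℝ ∞ g)
    (hf0 : f 0 = 0) (hf1 : deriv f 0 = 1) (hg0 : g 0 = 1) :
    ∃ τ : ℝ → ℝ, ContDiff ℝ ∞ τ ∧ τ 0 = 0 ∧ deriv τ 0 = 1 ∧
    ∃ a : ℕ → ℕ → ℕ → ℕ → ℝ,
    ∀ K : Set (PNKepler.PhaseSpace d), IsCompact K → K ⊆ PNKepler.puncturedPhaseSpace d →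
    ∃ (U : Set (PNKepler.PhaseSpace d)) (ε₀ C : ℝ)
      (Φ : ℝ → PNKepler.PhaseSpace d → PNKepler.PhaseSpace d),
      IsOpen U ∧ K ⊆ U ∧ U ⊆ PNKepler.puncturedPhaseSpace d ∧ 0 < ε₀ ∧
      PNKepler.IsNearIdentityCanonicalOn Φ ε₀ U ∧
      (∀ ε ∈ Set.Ioo (-ε₀) ε₀, PNKepler.IsLieTransformComposition 5 a ε (Φ ε) U) ∧
      ∀ ε ∈ Set.Ioo (-ε₀) ε₀, ∀ x ∈ U,
        let H : ℝ := τ (ε * PNKepler.keplerHamiltonian (Φ ε x))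
        |f H - (ε * (PNKepler.momentumSq x / 2) - g H * (ε / PNKepler.radius x))|
          ≤ C * |ε| ^ 7 := by
  obtain ⟨τ, hτ, hτ0, hτ1, hτf⟩ := exists_contDiff_inverse hf hg hf0 hf1 hg0
  refine ⟨τ, hτ, hτ0, hτ1, ?_⟩
  choose a ha using fun i => PNKepler.exists_pnPolynomial_eq (PNKepler.isHomogeneous_lieCoeff
    (fun k => iteratedDeriv k (fun y => g (τ y)) 0 / k.factorial) i)
  exact ⟨a, fun K hK hKM => PNKepler.exists_lieTransform_solution hg hτ hg0 hτ0 hτf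
    (fun _ => rfl) (fun i x => ha i x) hK hKM⟩
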